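/- In the problem Conflict-Free Cut, an instance is a pair $(G,\hat G)$, where $G$ is a finite simple connected graph and $\hat G$ (the conflict graph) is a simple graph with vertex set $V(\hat G)=E(G)$; the question is whether there is a set $F\subseteq E(G)$ such that $G-F$ is disconnected and $F$ is an independent set of $\hat G$. Theorem. Conflict-Free Cut is fixed-parameter tractable with the vertex cover number $k$ of $G$ as the parameter. More precisely, there is an algorithm that decides every instance $(G,\hat G)$ in time $2^k\cdot n^{O(1)}$, where $n=|V(G)|$ and $k$ is the minimum cardinality of a vertex cover of $G$. (Running times are counted on a unit-cost random access machine with addition and subtraction; the input consists of $n$ in unary and the adjacency matrices of $G$ and $\hat G$, and $k$ is not part of the input.) -/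

import Mathlib

/-! ### Random access machines

A random access machine has registers `reg 0, reg 1, …` and a memory `mem 0, mem 1, …`, all
holding natural numbers. A program is written with the usual structured control flow; every
elementary instruction and every evaluation of a branching condition is one step. Addition and
truncated subtraction are the only arithmetic operations (there is no multiplication). -/

namespace RAM

/-- Programs. A program mentions only finitely many registers. -/
inductive Program : Type
  /-- do nothing -/
  | skip : Program
  /-- `reg r := c` -/
  | const (r c : ℕ) : Program
  /-- `reg r := reg a + reg b` -/
  | add (r a b : ℕ) : Program
  /-- `reg r := reg a - reg b`, truncated at `0` -/
  | sub (r a b : ℕ) : Program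
  /-- `reg r := mem (reg a)` -/
  | load (r a : ℕ) : Program
  /-- `mem (reg a) := reg b` -/
  | store (a b : ℕ) : Program
  /-- first `P`, then `Q` -/
  | seq (P Q : Program) : Program
  /-- if `reg r ≠ 0` then `P` else `Q` -/
  | cond (r : ℕ) (P Q : Program) : Program
  /-- while `reg r ≠ 0` do `P` -/
  | loop (r : ℕ) (P : Program) : Program

/-- The contents of the registers and of the memory. -/
@[ext] structure State : Type where
  reg : ℕ → ℕ
  mem : ℕ → ℕ

/-- Write the value `v` into register `r`. -/
def State.setReg (s : State) (r v : ℕ) : State :=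
  { s with reg := Function.update s.reg r v }

/-- Write the value `v` into memory cell `a`. -/
def State.setMem (s : State) (a v : ℕ) : State :=
  { s with mem := Function.update s.mem a v }

/-- `Runs P s s' t`: the program `P`, started in the state `s`, halts in the state `s'` after
exactly `t` steps. -/
inductive Runs : Program → State → State → ℕ → Prop
  | skip (s : State) : Runs .skip s s 1
  | const (r c : ℕ) (s : State) : Runs (.const r c) s (s.setReg r c) 1
  | add (r a b : ℕ) (s : State) : Runs (.add r a b) s (s.setReg r (s.reg a + s.reg b)) 1
  | sub (r a b : ℕ) (s : State) : Runs (.sub r a b) s (s.setReg r (s.reg a - s.reg b)) 1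
  | load (r a : ℕ) (s : State) : Runs (.load r a) s (s.setReg r (s.mem (s.reg a))) 1
  | store (a b : ℕ) (s : State) : Runs (.store a b) s (s.setMem (s.reg a) (s.reg b)) 1
  | seq {P Q : Program} {s s' s'' : State} {t t' : ℕ} :
      Runs P s s' t → Runs Q s' s'' t' → Runs (.seq P Q) s s'' (t + t')
  | cond_then {r : ℕ} {P Q : Program} {s s' : State} {t : ℕ} :
      s.reg r ≠ 0 → Runs P s s' t → Runs (.cond r P Q) s s' (t + 1)
  | cond_else {r : ℕ} {P Q : Program} {s s' : State} {t : ℕ} :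
      s.reg r = 0 → Runs Q s s' t → Runs (.cond r P Q) s s' (t + 1)
  | loop_exit {r : ℕ} {P : Program} {s : State} :
      s.reg r = 0 → Runs (.loop r P) s s 1
  | loop_step {r : ℕ} {P : Program} {s s' s'' : State} {t t' : ℕ} :
      s.reg r ≠ 0 → Runs P s s' t → Runs (.loop r P) s' s'' t' →
      Runs (.loop r P) s s'' (t + t' + 1)

/-- The start state on the input word `w`: the word is in the memory cells
`0, …, w.length - 1` (one symbol per cell, as `0` or `1`), its length is in register `0`, and
everything else is `0`. -/
def State.start (w : List Bool) : State where
  reg := fun r => if r = 0 then w.length else 0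
  mem := fun i => if w[i]? = some true then 1 else 0

/-- `P` decides the problem `L` (a property of the instances in `α`, which are given to the
machine as words through `enc`) within the running time `T`: on every instance it halts after at
most `T x` steps, with `1` in register `0` on yes-instances and `0` on no-instances. -/
def Program.DecidesInTime {α : Type} (P : Program) (enc : α → List Bool) (L : α → Prop)
    (T : α → ℕ) : Prop :=
  ∀ x : α, ∃ (s : State) (t : ℕ), Runs P (State.start (enc x)) s t ∧ t ≤ T x ∧
    (L x → s.reg 0 = 1) ∧ (¬ L x → s.reg 0 = 0)

end RAM

/-- The problem `L`, with instances encoded by `enc`, is fixed-parameter tractable with respect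
to the parameter `κ`: some program decides it in time `f (κ x) * |x| ^ O(1)`, with `f` a
computable function. (The value of the parameter is not part of the input.) -/
def FixedParameterTractable {α : Type} (enc : α → List Bool) (L : α → Prop) (κ : α → ℕ) : Prop :=
  ∃ (f : ℕ → ℕ) (p : Polynomial ℕ) (P : RAM.Program), Computable f ∧
    P.DecidesInTime enc L (fun x => f (κ x) * p.eval (enc x).length)

/-! ### Conflict-Free Cut -/

namespace ConflictFreeCut

/-- An instance: a finite connected graph `G` and a conflict graph whose vertices are the edges
of `G`. -/
structure Instance : Type where
  /-- the number of vertices of the input graph -/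
  n : ℕ
  /-- the input graph -/
  G : SimpleGraph (Fin n)
  connected : G.Connected
  /-- the conflict graph -/
  conflict : SimpleGraph G.edgeSet

/-- The set `F` of edges is a conflict-free cut: `G - F` is disconnected, and `F` is independent
in the conflict graph. -/
def Instance.IsConflictFreeCut (I : Instance) (F : Set I.G.edgeSet) : Prop :=
  ¬ (I.G.deleteEdges (Subtype.val '' F)).Connected ∧ I.conflict.IsIndepSet F

/-- The question of the decision problem. -/
def Instance.HasConflictFreeCut (I : Instance) : Prop :=
  ∃ F : Set I.G.edgeSet, I.IsConflictFreeCut F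

/-- The vertex cover number of the input graph. -/
noncomputable def Instance.vertexCoverNumber (I : Instance) : ℕ :=
  I.G.vertexCoverNum.toNat

/-- `uv` and `xy` are edges of the input graph, and they are in conflict. -/
def Instance.Conflicting (I : Instance) (u v x y : Fin I.n) : Prop :=
  ∃ (h : I.G.Adj u v) (h' : I.G.Adj x y),
    I.conflict.Adj ⟨s(u, v), h⟩ ⟨s(x, y), h'⟩

open Classical in
/-- The word that encodes an instance: the number `n` of vertices in unary, closed by `false`;
the adjacency matrix of the input graph row by row (`n ^ 2` bits); and the adjacency matrix of the
conflict graph, with rows and columns indexed by the ordered pairs of vertices, row by row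
(`n ^ 4` bits). -/
noncomputable def Instance.encode (I : Instance) : List Bool :=
  List.replicate I.n true ++ [false]
    ++ List.ofFn (fun i : Fin (I.n * I.n) => decide (I.G.Adj i.divNat i.modNat))
    ++ List.ofFn (fun i : Fin ((I.n * I.n) * (I.n * I.n)) =>
        decide (I.Conflicting i.divNat.divNat i.divNat.modNat i.modNat.divNat i.modNat.modNat))

end ConflictFreeCut

/-! Colour each vertex by the side of the cut on which it lies. A conflict-free cut exists exactly
when the vertices have a nonconstant 2-colouring in which no two bichromatic edges are in conflict
(`Instance.hasConflictFreeCut_iff`). Take a vertex cover `X` of size at most `k`, fix its colours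
(at most `2 ^ k` ways), and fix two vertices `w`, `w'` that must be coloured and uncoloured. Every
edge now has an end of known colour, so whether it is bichromatic depends on one literal about the
other end, and each conflict becomes a clause of two literals. What remains is 2-satisfiability,
decided by closing the implication relation transitively and looking for a literal equivalent to its
negation (`exists_assignment`, `consistent_iff`).

Since `k` is not given, the cover must be found within the same time. For the budgets `0, 1, 2, …`,
each bit string whose length is the budget guides a greedy pass over all pairs of vertices: at an
uncovered edge, the next bit selects the end to be taken. The result is always a vertex cover, and
if one of size at most the budget exists, then some string makes no more insertions than the budget
allows (`exists_cover_le`). So the first successful budget `J` is at most `k`, and by the geometric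
series the search takes fewer than `2 ^ (J + 1)` passes. Bit strings of length `J` then enumerate
the colourings of the cover (`exists_colour`).

For the machine, the polynomial parts are written in a small language whose loops make `n` or `2 *
n` passes. Its compiler is correct (`Cmd.compile_runs`), and the cost of every command is polynomial
in `n` by its form (`Cmd.exists_cost_polynomial`). The loops over budgets and bit strings are put
around compiled commands by means of `Triple.loop`. -/

namespace RAM

/-! ### Programs with bounded loops and their compilation -/

@[simp] theorem State.setReg_reg (s : State) (r v x : ℕ) :
    (s.setReg r v).reg x = if x = r then v else s.reg x := by
  simp [State.setReg, Function.update_apply]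

@[simp] theorem State.setReg_mem (s : State) (r v : ℕ) : (s.setReg r v).mem = s.mem := rfl

@[simp] theorem State.setMem_reg (s : State) (a v : ℕ) : (s.setMem a v).reg = s.reg := rfl

@[simp] theorem State.setMem_mem (s : State) (a v x : ℕ) :
    (s.setMem a v).mem x = if x = a then v else s.mem x := by
  simp [State.setMem, Function.update_apply]

/-- `iter f n a` applies `f 0`, …, `f (n - 1)` to `a`, in this order. -/
def iter {α : Type*} (f : ℕ → α → α) : ℕ → α → α
  | 0, a => a
  | i + 1, a => f i (iter f i a)

/-- Loop bounds: `n` or `2 * n`. -/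
def bound (n : ℕ) (b : Bool) : ℕ := if b then n + n else n

@[simp] theorem bound_false (n : ℕ) : bound n false = n := rfl

@[simp] theorem bound_true (n : ℕ) : bound n true = n + n := rfl

theorem bound_le (n : ℕ) (b : Bool) : bound n b ≤ 2 * n := by
  cases b <;> simp <;> omega

/-- Expressions over named variables, with a size parameter and sums bounded in terms of it. -/
inductive Expr : Type
  | var (v : ℕ)
  | size
  | lit (c : ℕ)
  | add (e e' : Expr)
  | sub (e e' : Expr)
  | load (e : Expr)
  | scale (e : Expr)
  | ite (e e' e'' : Expr)
  | sum (b : Bool) (x : ℕ) (e : Expr)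

/-- The value of an expression; the variables are the registers of the state. -/
def Expr.eval (n : ℕ) : Expr → State → ℕ
  | var v, σ => σ.reg v
  | size, _ => n
  | lit c, _ => c
  | add e e', σ => e.eval n σ + e'.eval n σ
  | sub e e', σ => e.eval n σ - e'.eval n σ
  | load e, σ => σ.mem (e.eval n σ)
  | scale e, σ => n * e.eval n σ
  | ite e e' e'', σ => if e.eval n σ ≠ 0 then e'.eval n σ else e''.eval n σ
  | sum b x e, σ => ∑ i ∈ Finset.range (bound n b), e.eval n (σ.setReg x i)

/-- Commands with bounded loops. -/
inductive Cmd : Type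
  | skip
  | assign (v : ℕ) (e : Expr)
  | store (e e' : Expr)
  | seq (c c' : Cmd)
  | ite (e : Expr) (c c' : Cmd)
  | loop (b : Bool) (x : ℕ) (c : Cmd)

/-- The effect of a command on the state. -/
def Cmd.eval (n : ℕ) : Cmd → State → State
  | skip, σ => σ
  | assign v e, σ => σ.setReg v (e.eval n σ)
  | store e e', σ => σ.setMem (e.eval n σ) (e'.eval n σ)
  | seq c c', σ => c'.eval n (c.eval n σ)
  | ite e c c', σ => if e.eval n σ ≠ 0 then c.eval n σ else c'.eval n σ
  | loop b x c, σ => iter (fun i τ => c.eval n (τ.setReg x i)) (bound n b) σ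

/-- The machine state `s` represents the state `σ` of the variables: the size parameter `n` is in
register `1` and `2 * n` in register `3`, variable `v` is in register `2 * v + 5`. The registers of
even number are scratch registers. -/
structure Represents (n : ℕ) (s σ : State) : Prop where
  size : s.reg 1 = n
  double : s.reg 3 = n + n
  var : ∀ v, s.reg (2 * v + 5) = σ.reg v
  mem : s.mem = σ.mem

/-- The register that holds a loop bound. -/
def boundReg (b : Bool) : ℕ := if b then 3 else 1

theorem Represents.boundReg {n : ℕ} {s σ : State} (h : Represents n s σ) (b : Bool) :
    s.reg (boundReg b) = bound n b := by
  cases b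
  · exact h.size
  · exact h.double

theorem Represents.setTemp {n : ℕ} {s σ : State} (h : Represents n s σ) (d v : ℕ) :
    Represents n (s.setReg (2 * d) v) σ := by
  refine ⟨?_, ?_, fun w => ?_, h.mem⟩
  · rw [State.setReg_reg, if_neg (by omega), h.size]
  · rw [State.setReg_reg, if_neg (by omega), h.double]
  · rw [State.setReg_reg, if_neg (by omega), h.var]

theorem Represents.setVar {n : ℕ} {s σ : State} (h : Represents n s σ) (x v : ℕ) :
    Represents n (s.setReg (2 * x + 5) v) (σ.setReg x v) := by
  refine ⟨?_, ?_, fun w => ?_, h.mem⟩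
  · rw [State.setReg_reg, if_neg (by omega), h.size]
  · rw [State.setReg_reg, if_neg (by omega), h.double]
  · rw [State.setReg_reg, State.setReg_reg, h.var]
    by_cases hw : w = x
    · simp [hw]
    · rw [if_neg (by omega), if_neg hw]

theorem Represents.setMem {n : ℕ} {s σ : State} (h : Represents n s σ) (a v : ℕ) :
    Represents n (s.setMem a v) (σ.setMem a v) :=
  ⟨h.size, h.double, h.var, by simp only [State.setMem, h.mem]⟩

theorem State.setReg_setReg (s : State) (x v w : ℕ) :
    (s.setReg x v).setReg x w = s.setReg x w := by
  simp [State.setReg]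

theorem State.setReg_self (s : State) (x : ℕ) : s.setReg x (s.reg x) = s := by
  simp [State.setReg]

/-- A loop that lets scratch register `2 * d` run from `0` up to the value of register `r`. -/
def upLoop (r d : ℕ) (body : Program) : Program :=
  .seq (.const (2 * d) 0) (.seq (.sub (2 * (d + 1)) r (2 * d))
    (.loop (2 * (d + 1)) (.seq body (.seq (.const (2 * (d + 1)) 1)
      (.seq (.add (2 * d) (2 * d) (2 * (d + 1))) (.sub (2 * (d + 1)) r (2 * d)))))))

/-- The invariant must ignore the two control registers, because the loop overwrites them between
passes. A pass costs the body, three bookkeeping instructions and one branching step, hence `T + 4`;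
the final `3` pays for the two initial instructions and the exit. -/
theorem upLoop_runs {r d N T : ℕ} {body : Program} (I : ℕ → State → Prop)
    (hN : ∀ i s, I i s → s.reg r = N)
    (hI : ∀ i s v, I i s → I i (s.setReg (2 * d) v) ∧ I i (s.setReg (2 * (d + 1)) v))
    (hbody : ∀ i s, i < N → I i s → s.reg (2 * d) = i →
      ∃ s' t, Runs body s s' t ∧ t ≤ T ∧ I (i + 1) s' ∧ s'.reg (2 * d) = i)
    {s : State} (h0 : I 0 s) :
    ∃ s' t, Runs (upLoop r d body) s s' t ∧ t ≤ N * (T + 4) + 3 ∧ I N s' := by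
  have key : ∀ m i s, i + m = N → I i s → s.reg (2 * d) = i → s.reg (2 * (d + 1)) = N - i →
      ∃ s' t, Runs (.loop (2 * (d + 1)) (.seq body (.seq (.const (2 * (d + 1)) 1)
      (.seq (.add (2 * d) (2 * d) (2 * (d + 1))) (.sub (2 * (d + 1)) r (2 * d)))))) s s' t ∧
      t ≤ m * (T + 4) + 1 ∧ I N s' := by
    intro m
    induction m with
    | zero =>
      intro i s hi hs _ h2
      exact ⟨s, 1, .loop_exit (by omega), by omega, by rwa [← hi]⟩
    | succ m ih =>
      intro i s hi hs h1 h2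
      obtain ⟨s₁, t₁, hr₁, ht₁, hI₁, hd₁⟩ := hbody i s (by omega) hs h1
      have hI₂ := (hI _ _ 1 hI₁).2
      have hI₃ := (hI _ _ (i + 1) hI₂).1
      have hI₄ := (hI _ _ (N - (i + 1)) hI₃).2
      have e3 : ((s₁.setReg (2 * (d + 1)) 1).setReg (2 * d)
          ((s₁.setReg (2 * (d + 1)) 1).reg (2 * d) +
            (s₁.setReg (2 * (d + 1)) 1).reg (2 * (d + 1)))) =
          (s₁.setReg (2 * (d + 1)) 1).setReg (2 * d) (i + 1) := by
        congr 1
        rw [State.setReg_reg, if_neg (by omega), State.setReg_reg, if_pos rfl, hd₁]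
      have r3 := Runs.add (2 * d) (2 * d) (2 * (d + 1)) (s₁.setReg (2 * (d + 1)) 1)
      rw [e3] at r3
      have r4 := Runs.sub (2 * (d + 1)) r (2 * d)
        ((s₁.setReg (2 * (d + 1)) 1).setReg (2 * d) (i + 1))
      rw [hN _ _ hI₃, State.setReg_reg _ (2 * d), if_pos rfl] at r4
      obtain ⟨s', t, hr, ht, hs'⟩ := ih (i + 1) _ (by omega) hI₄
        (by rw [State.setReg_reg, if_neg (by omega), State.setReg_reg, if_pos rfl])
        (by rw [State.setReg_reg, if_pos rfl])
      refine ⟨s', _, .loop_step (by omega) (.seq hr₁ (.seq (.const _ _ _) (.seq r3 r4))) hr,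
        ?_, hs'⟩
      have : (m + 1) * (T + 4) = m * (T + 4) + (T + 4) := by ring
      omega
  have r1 := Runs.const (2 * d) 0 s
  have h1 := (hI _ _ 0 h0).1
  have r2 := Runs.sub (2 * (d + 1)) r (2 * d) (s.setReg (2 * d) 0)
  rw [hN _ _ h1, State.setReg_reg _ (2 * d), if_pos rfl] at r2
  obtain ⟨s', t, hr, ht, hs'⟩ := key N 0 _ (by omega) (hI _ _ (N - 0) h1).2
    (by rw [State.setReg_reg, if_neg (by omega), State.setReg_reg, if_pos rfl])
    (by rw [State.setReg_reg, if_pos rfl])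
  exact ⟨s', _, .seq r1 (.seq r2 hr), by omega, hs'⟩

/-- `reg r := reg a`. -/
def move (r a : ℕ) : Program := .seq (.const r 0) (.add r r a)

theorem move_runs {r a : ℕ} (h : a ≠ r) (s : State) :
    Runs (move r a) s (s.setReg r (s.reg a)) 2 := by
  have r2 := Runs.add r r a (s.setReg r 0)
  rw [State.setReg_reg, State.setReg_reg, if_pos rfl, if_neg h, State.setReg_setReg, zero_add] at r2
  exact .seq (.const r 0 s) r2

/-- Compilation of an expression: the value is left in scratch register `2 * d`, and the lower
scratch registers are not touched. -/
def Expr.compile : Expr → ℕ → Program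
  | var v, d => move (2 * d) (2 * v + 5)
  | size, d => move (2 * d) 1
  | lit c, d => .const (2 * d) c
  | add e e', d => .seq (e.compile d) (.seq (e'.compile (d + 1))
      (.add (2 * d) (2 * d) (2 * (d + 1))))
  | sub e e', d => .seq (e.compile d) (.seq (e'.compile (d + 1))
      (.sub (2 * d) (2 * d) (2 * (d + 1))))
  | load e, d => .seq (e.compile d) (.load (2 * d) (2 * d))
  | scale e, d => .seq (e.compile d) (.seq (.const (2 * (d + 1)) 0)
      (.seq (upLoop 1 (d + 2) (.add (2 * (d + 1)) (2 * (d + 1)) (2 * d)))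
        (move (2 * d) (2 * (d + 1)))))
  | ite e e' e'', d => .seq (e.compile d) (.cond (2 * d) (e'.compile d) (e''.compile d))
  | sum b x e, d => .seq (move (2 * d) (2 * x + 5)) (.seq (.const (2 * (d + 1)) 0)
      (.seq (upLoop (boundReg b) (d + 2) (.seq (move (2 * x + 5) (2 * (d + 2)))
          (.seq (e.compile (d + 4)) (.add (2 * (d + 1)) (2 * (d + 1)) (2 * (d + 4))))))
        (.seq (move (2 * x + 5) (2 * d)) (move (2 * d) (2 * (d + 1))))))

/-- A bound for the running time of a compiled expression in terms of the size parameter. -/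
def Expr.cost (n : ℕ) : Expr → ℕ
  | var _ => 2
  | size => 2
  | lit _ => 1
  | add e e' => e.cost n + e'.cost n + 1
  | sub e e' => e.cost n + e'.cost n + 1
  | load e => e.cost n + 1
  | scale e => e.cost n + 2 * n * 5 + 6
  | ite e e' e'' => e.cost n + e'.cost n + e''.cost n + 1
  | sum _ _ e => 2 * n * (e.cost n + 7) + 10

/-- `s'` agrees with `s` on the scratch registers below `2 * d`. -/
def KeepsBelow (d : ℕ) (s s' : State) : Prop := ∀ d' < d, s'.reg (2 * d') = s.reg (2 * d')

theorem KeepsBelow.refl (d : ℕ) (s : State) : KeepsBelow d s s := fun _ _ => rfl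

theorem KeepsBelow.setTemp {d d' : ℕ} {s s' : State} (h : KeepsBelow d s s') (hd : d ≤ d')
    (v : ℕ) : KeepsBelow d s (s'.setReg (2 * d') v) := fun e he => by
  rw [State.setReg_reg, if_neg (by omega), h e he]

theorem KeepsBelow.setVar {d : ℕ} {s s' : State} (h : KeepsBelow d s s') (x v : ℕ) :
    KeepsBelow d s (s'.setReg (2 * x + 5) v) := fun e he => by
  rw [State.setReg_reg, if_neg (by omega), h e he]

theorem KeepsBelow.setMem {d : ℕ} {s s' : State} (h : KeepsBelow d s s') (a v : ℕ) :
    KeepsBelow d s (s'.setMem a v) := h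

theorem KeepsBelow.trans {d d' : ℕ} {s s' s'' : State} (h : KeepsBelow d s s')
    (h' : KeepsBelow d' s' s'') (hd : d ≤ d') : KeepsBelow d s s'' := fun e he => by
  rw [h' e (by omega), h e he]

/-- Variables live in odd registers, temporaries in even ones. A second operand is evaluated at
depth `d + 1` and spares the scratch registers below, so the first value survives in register `2 *
d`; this is why `KeepsBelow` is carried through the induction. -/
theorem Expr.compile_runs (n : ℕ) (e : Expr) (d : ℕ) {s σ : State} (h : Represents n s σ) :
    ∃ s' t, Runs (e.compile d) s s' t ∧ t ≤ e.cost n ∧ Represents n s' σ ∧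
      s'.reg (2 * d) = e.eval n σ ∧ KeepsBelow d s s' := by
  induction e generalizing d s σ with
  | var v =>
    refine ⟨_, _, move_runs (by omega) s, le_rfl, h.setTemp _ _, ?_,
      (KeepsBelow.refl d s).setTemp le_rfl _⟩
    simp [Expr.eval, h.var]
  | size =>
    refine ⟨_, _, move_runs (by omega) s, le_rfl, h.setTemp _ _, ?_,
      (KeepsBelow.refl d s).setTemp le_rfl _⟩
    simp [Expr.eval, h.size]
  | lit c =>
    exact ⟨_, _, .const _ _ _, le_rfl, h.setTemp _ _, by simp [Expr.eval],
      (KeepsBelow.refl d s).setTemp le_rfl _⟩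
  | add e e' ih ih' =>
    obtain ⟨s₁, t₁, r₁, ht₁, h₁, v₁, k₁⟩ := ih d h
    obtain ⟨s₂, t₂, r₂, ht₂, h₂, v₂, k₂⟩ := ih' (d + 1) h₁
    refine ⟨_, _, .seq r₁ (.seq r₂ (.add _ _ _ _)), by simp only [Expr.cost]; omega,
      h₂.setTemp _ _, ?_, (k₁.trans k₂ (by omega)).setTemp le_rfl _⟩
    rw [State.setReg_reg, if_pos rfl, v₂, k₂ d (by omega), v₁, Expr.eval]
  | sub e e' ih ih' =>
    obtain ⟨s₁, t₁, r₁, ht₁, h₁, v₁, k₁⟩ := ih d h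
    obtain ⟨s₂, t₂, r₂, ht₂, h₂, v₂, k₂⟩ := ih' (d + 1) h₁
    refine ⟨_, _, .seq r₁ (.seq r₂ (.sub _ _ _ _)), by simp only [Expr.cost]; omega,
      h₂.setTemp _ _, ?_, (k₁.trans k₂ (by omega)).setTemp le_rfl _⟩
    rw [State.setReg_reg, if_pos rfl, v₂, k₂ d (by omega), v₁, Expr.eval]
  | load e ih =>
    obtain ⟨s₁, t₁, r₁, ht₁, h₁, v₁, k₁⟩ := ih d h
    refine ⟨_, _, .seq r₁ (.load _ _ _), by simp only [Expr.cost]; omega,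
      h₁.setTemp _ _, ?_, k₁.setTemp le_rfl _⟩
    rw [State.setReg_reg, if_pos rfl, v₁, h₁.mem, Expr.eval]
  | ite e e' e'' ih ih' ih'' =>
    obtain ⟨s₁, t₁, r₁, ht₁, h₁, v₁, k₁⟩ := ih d h
    by_cases hc : e.eval n σ = 0
    · obtain ⟨s₂, t₂, r₂, ht₂, h₂, v₂, k₂⟩ := ih'' d h₁
      exact ⟨_, _, .seq r₁ (.cond_else (by omega) r₂), by simp only [Expr.cost]; omega, h₂,
        by rw [v₂, Expr.eval]; simp [hc], k₁.trans k₂ le_rfl⟩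
    · obtain ⟨s₂, t₂, r₂, ht₂, h₂, v₂, k₂⟩ := ih' d h₁
      exact ⟨_, _, .seq r₁ (.cond_then (by omega) r₂), by simp only [Expr.cost]; omega, h₂,
        by rw [v₂, Expr.eval]; simp [hc], k₁.trans k₂ le_rfl⟩
  | scale e ih =>
    obtain ⟨s₁, t₁, r₁, ht₁, h₁, v₁, k₁⟩ := ih d h
    have r₂ := Runs.const (2 * (d + 1)) 0 s₁
    obtain ⟨s₃, t₃, r₃, ht₃, h₃, k₃, v₃, a₃⟩ := upLoop_runs (r := 1) (d := d + 2) (N := n)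
      (T := 1) (body := .add (2 * (d + 1)) (2 * (d + 1)) (2 * d))
      (fun i s' => Represents n s' σ ∧ KeepsBelow d s s' ∧ s'.reg (2 * d) = e.eval n σ ∧
        s'.reg (2 * (d + 1)) = i * e.eval n σ)
      (fun i s' h' => h'.1.size)
      (fun i s' v h' => by
        refine ⟨⟨h'.1.setTemp _ _, h'.2.1.setTemp (by omega) _, ?_, ?_⟩,
          ⟨h'.1.setTemp _ _, h'.2.1.setTemp (by omega) _, ?_, ?_⟩⟩ <;>
        rw [State.setReg_reg, if_neg (by omega)]
        exacts [h'.2.2.1, h'.2.2.2, h'.2.2.1, h'.2.2.2])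
      (fun i s' hi h' hd => by
        refine ⟨_, _, .add _ _ _ _, le_rfl, ⟨h'.1.setTemp _ _, h'.2.1.setTemp (by omega) _,
          ?_, ?_⟩, ?_⟩
        · rw [State.setReg_reg, if_neg (by omega), h'.2.2.1]
        · rw [State.setReg_reg, if_pos rfl, h'.2.2.1, h'.2.2.2]; ring
        · rw [State.setReg_reg, if_neg (by omega), hd])
      (s := s₁.setReg (2 * (d + 1)) 0)
      ⟨h₁.setTemp _ _, k₁.setTemp (by omega) _, by
        rw [State.setReg_reg, if_neg (by omega), v₁], by simp⟩
    refine ⟨_, _, .seq r₁ (.seq r₂ (.seq r₃ (move_runs (by omega) _))), ?_, h₃.setTemp _ _, ?_,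
      k₃.setTemp le_rfl _⟩
    · simp only [Expr.cost]; omega
    · rw [State.setReg_reg, if_pos rfl, a₃, Expr.eval]
  | sum b x e ih =>
    have r₁ := move_runs (r := 2 * d) (a := 2 * x + 5) (by omega) s
    rw [h.var] at r₁
    have h₁ := h.setTemp d (σ.reg x)
    have r₂ := Runs.const (2 * (d + 1)) 0 (s.setReg (2 * d) (σ.reg x))
    -- Inside the loop, variable `x` holds the summation index, so `σ` is represented only up to the
    -- value of `x`; the old value waits in register `2 * d` and is put back afterwards. Depths `d +
    -- 1` to `d + 3` hold the accumulator and the loop control, so `e` is compiled at `d + 4`.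
    obtain ⟨s₃, t₃, r₃, ht₃, ⟨w, h₃⟩, k₃, v₃, a₃⟩ := upLoop_runs (r := boundReg b) (d := d + 2)
      (N := bound n b) (T := e.cost n + 3)
      (body := .seq (move (2 * x + 5) (2 * (d + 2)))
          (.seq (e.compile (d + 4)) (.add (2 * (d + 1)) (2 * (d + 1)) (2 * (d + 4)))))
      (fun i s' => (∃ w, Represents n s' (σ.setReg x w)) ∧ KeepsBelow d s s' ∧
        s'.reg (2 * d) = σ.reg x ∧
        s'.reg (2 * (d + 1)) = ∑ j ∈ Finset.range i, e.eval n (σ.setReg x j))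
      (fun i s' h' => h'.1.choose_spec.boundReg b)
      (fun i s' v h' => by
        refine ⟨⟨⟨_, h'.1.choose_spec.setTemp _ _⟩, h'.2.1.setTemp (by omega) _, ?_, ?_⟩,
          ⟨⟨_, h'.1.choose_spec.setTemp _ _⟩, h'.2.1.setTemp (by omega) _, ?_, ?_⟩⟩ <;>
        rw [State.setReg_reg, if_neg (by omega)]
        exacts [h'.2.2.1, h'.2.2.2, h'.2.2.1, h'.2.2.2])
      (fun i s' hi h' hd => by
        obtain ⟨⟨w, hw⟩, k', v', a'⟩ := h'
        have q₁ := move_runs (r := 2 * x + 5) (a := 2 * (d + 2)) (by omega) s'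
        rw [hd] at q₁
        have g₁ := hw.setVar x i
        rw [State.setReg_setReg] at g₁
        obtain ⟨s₂, t₂, q₂, ht₂, g₂, v₂, k₂⟩ := ih (d + 4) g₁
        refine ⟨_, _, .seq q₁ (.seq q₂ (.add _ _ _ _)), by omega, ⟨⟨i, g₂.setTemp _ _⟩,
          ((k'.setVar _ _).trans k₂ (by omega)).setTemp (by omega) _, ?_, ?_⟩, ?_⟩
        · rw [State.setReg_reg, if_neg (by omega), k₂ d (by omega), State.setReg_reg,
            if_neg (by omega), v']
        · rw [State.setReg_reg, if_pos rfl, k₂ (d + 1) (by omega), State.setReg_reg,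
            if_neg (by omega), a', v₂, Finset.sum_range_succ]
        · rw [State.setReg_reg, if_neg (by omega), k₂ (d + 2) (by omega), State.setReg_reg,
            if_neg (by omega), hd])
      (s := (s.setReg (2 * d) (σ.reg x)).setReg (2 * (d + 1)) 0)
      ⟨⟨σ.reg x, by rw [State.setReg_self]; exact h₁.setTemp _ _⟩,
        ((KeepsBelow.refl d s).setTemp le_rfl _).setTemp (by omega) _, by
        rw [State.setReg_reg, if_neg (by omega), State.setReg_reg, if_pos rfl], by simp⟩
    have r₄ := move_runs (r := 2 * x + 5) (a := 2 * d) (by omega) s₃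
    rw [v₃] at r₄
    have h₄ := h₃.setVar x (σ.reg x)
    rw [State.setReg_setReg, State.setReg_self] at h₄
    refine ⟨_, _, .seq r₁ (.seq r₂ (.seq r₃ (.seq r₄ (move_runs (by omega) _)))), ?_,
      h₄.setTemp _ _, ?_, (k₃.setVar _ _).setTemp le_rfl _⟩
    · have := Nat.mul_le_mul_right (e.cost n + 7) (bound_le n b)
      change t₃ ≤ bound n b * (e.cost n + 7) + 3 at ht₃
      simp only [Expr.cost]; omega
    · rw [State.setReg_reg, if_pos rfl, State.setReg_reg, if_neg (by omega), a₃, Expr.eval]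

/-- Compilation of a command that may use the scratch registers from `2 * d` on. -/
def Cmd.compile : Cmd → ℕ → Program
  | skip, _ => .skip
  | assign v e, d => .seq (e.compile d) (move (2 * v + 5) (2 * d))
  | store e e', d => .seq (e.compile d) (.seq (e'.compile (d + 1)) (.store (2 * d) (2 * (d + 1))))
  | seq c c', d => .seq (c.compile d) (c'.compile d)
  | ite e c c', d => .seq (e.compile d) (.cond (2 * d) (c.compile d) (c'.compile d))
  | loop b x c, d => upLoop (boundReg b) d (.seq (move (2 * x + 5) (2 * d)) (c.compile (d + 2)))

/-- A bound for the running time of a compiled command in terms of the size parameter. -/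
def Cmd.cost (n : ℕ) : Cmd → ℕ
  | skip => 1
  | assign _ e => e.cost n + 2
  | store e e' => e.cost n + e'.cost n + 1
  | seq c c' => c.cost n + c'.cost n
  | ite e c c' => e.cost n + c.cost n + c'.cost n + 1
  | loop _ _ c => 2 * n * (c.cost n + 6) + 3

theorem Cmd.compile_runs (n : ℕ) (c : Cmd) (d : ℕ) {s σ : State} (h : Represents n s σ) :
    ∃ s' t, Runs (c.compile d) s s' t ∧ t ≤ c.cost n ∧ Represents n s' (c.eval n σ) ∧
      KeepsBelow d s s' := by
  induction c generalizing d s σ with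
  | skip => exact ⟨_, _, .skip _, le_rfl, h, .refl _ _⟩
  | assign v e =>
    obtain ⟨s₁, t₁, r₁, ht₁, h₁, v₁, k₁⟩ := e.compile_runs n d h
    refine ⟨_, _, .seq r₁ (move_runs (by omega) _), by simp only [Cmd.cost]; omega, ?_,
      k₁.setVar _ _⟩
    rw [v₁]
    exact h₁.setVar _ _
  | store e e' =>
    obtain ⟨s₁, t₁, r₁, ht₁, h₁, v₁, k₁⟩ := e.compile_runs n d h
    obtain ⟨s₂, t₂, r₂, ht₂, h₂, v₂, k₂⟩ := e'.compile_runs n (d + 1) h₁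
    refine ⟨_, _, .seq r₁ (.seq r₂ (.store _ _ _)), by simp only [Cmd.cost]; omega, ?_,
      (k₁.trans k₂ (by omega)).setMem _ _⟩
    rw [v₂, k₂ d (by omega), v₁]
    exact h₂.setMem _ _
  | seq c c' ih ih' =>
    obtain ⟨s₁, t₁, r₁, ht₁, h₁, k₁⟩ := ih d h
    obtain ⟨s₂, t₂, r₂, ht₂, h₂, k₂⟩ := ih' d h₁
    exact ⟨_, _, .seq r₁ r₂, by simp only [Cmd.cost]; omega, h₂, k₁.trans k₂ le_rfl⟩
  | ite e c c' ih ih' =>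
    obtain ⟨s₁, t₁, r₁, ht₁, h₁, v₁, k₁⟩ := e.compile_runs n d h
    by_cases hc : e.eval n σ = 0
    · obtain ⟨s₂, t₂, r₂, ht₂, h₂, k₂⟩ := ih' d h₁
      exact ⟨_, _, .seq r₁ (.cond_else (by omega) r₂), by simp only [Cmd.cost]; omega,
        by rw [Cmd.eval]; simpa [hc] using h₂, k₁.trans k₂ le_rfl⟩
    · obtain ⟨s₂, t₂, r₂, ht₂, h₂, k₂⟩ := ih d h₁
      exact ⟨_, _, .seq r₁ (.cond_then (by omega) r₂), by simp only [Cmd.cost]; omega,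
        by rw [Cmd.eval]; simpa [hc] using h₂, k₁.trans k₂ le_rfl⟩
  | loop b x c ih =>
    obtain ⟨s', t, r, ht, h', k'⟩ := upLoop_runs (r := boundReg b) (d := d)
      (N := bound n b) (T := c.cost n + 2)
      (body := .seq (move (2 * x + 5) (2 * d)) (c.compile (d + 2)))
      (fun i s' => Represents n s' (iter (fun i τ => c.eval n (τ.setReg x i)) i σ) ∧
        KeepsBelow d s s')
      (fun i s' h' => h'.1.boundReg b)
      (fun i s' v h' => ⟨⟨h'.1.setTemp _ _, h'.2.setTemp le_rfl _⟩,
        ⟨h'.1.setTemp _ _, h'.2.setTemp (by omega) _⟩⟩)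
      (fun i s' hi h' hd => by
        have q₁ := move_runs (r := 2 * x + 5) (a := 2 * d) (by omega) s'
        rw [hd] at q₁
        obtain ⟨s₂, t₂, q₂, ht₂, g₂, k₂⟩ := ih (d + 2) (h'.1.setVar x i)
        refine ⟨_, _, .seq q₁ q₂, by omega, ⟨g₂, (h'.2.setVar _ _).trans k₂ (by omega)⟩, ?_⟩
        rw [k₂ d (by omega), State.setReg_reg, if_neg (by omega), hd])
      ⟨h, .refl _ _⟩
    refine ⟨s', t, r, ?_, h', k'⟩
    have := Nat.mul_le_mul_right (c.cost n + 6) (bound_le n b)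
    change t ≤ bound n b * (c.cost n + 6) + 3 at ht
    simp only [Cmd.cost]; omega

/-! ### Polynomial running time -/

-- Each clause of the cost recursion combines the costs of the parts by sums, constants and factors
-- `2 * n`, so it never leaves the polynomials.
open Polynomial in
theorem Expr.exists_cost_polynomial (e : Expr) : ∃ p : ℕ[X], ∀ n, p.eval n = e.cost n := by
  induction e with
  | var v => exact ⟨2, fun n => by simp [Expr.cost]⟩
  | size => exact ⟨2, fun n => by simp [Expr.cost]⟩
  | lit c => exact ⟨1, fun n => by simp [Expr.cost]⟩
  | add e e' ih ih' =>
    obtain ⟨p, hp⟩ := ih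
    obtain ⟨q, hq⟩ := ih'
    exact ⟨p + q + 1, fun n => by simp [Expr.cost, hp, hq]⟩
  | sub e e' ih ih' =>
    obtain ⟨p, hp⟩ := ih
    obtain ⟨q, hq⟩ := ih'
    exact ⟨p + q + 1, fun n => by simp [Expr.cost, hp, hq]⟩
  | load e ih =>
    obtain ⟨p, hp⟩ := ih
    exact ⟨p + 1, fun n => by simp [Expr.cost, hp]⟩
  | scale e ih =>
    obtain ⟨p, hp⟩ := ih
    exact ⟨p + 2 * X * 5 + 6, fun n => by simp [Expr.cost, hp]⟩
  | ite e e' e'' ih ih' ih'' =>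
    obtain ⟨p, hp⟩ := ih
    obtain ⟨q, hq⟩ := ih'
    obtain ⟨r, hr⟩ := ih''
    exact ⟨p + q + r + 1, fun n => by simp [Expr.cost, hp, hq, hr]⟩
  | sum b x e ih =>
    obtain ⟨p, hp⟩ := ih
    exact ⟨2 * X * (p + 7) + 10, fun n => by simp [Expr.cost, hp]⟩

open Polynomial in
theorem Cmd.exists_cost_polynomial (c : Cmd) : ∃ p : ℕ[X], ∀ n, p.eval n = c.cost n := by
  induction c with
  | skip => exact ⟨1, fun n => by simp [Cmd.cost]⟩
  | assign v e =>
    obtain ⟨p, hp⟩ := e.exists_cost_polynomial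
    exact ⟨p + 2, fun n => by simp [Cmd.cost, hp]⟩
  | store e e' =>
    obtain ⟨p, hp⟩ := e.exists_cost_polynomial
    obtain ⟨q, hq⟩ := e'.exists_cost_polynomial
    exact ⟨p + q + 1, fun n => by simp [Cmd.cost, hp, hq]⟩
  | seq c c' ih ih' =>
    obtain ⟨p, hp⟩ := ih
    obtain ⟨q, hq⟩ := ih'
    exact ⟨p + q, fun n => by simp [Cmd.cost, hp, hq]⟩
  | ite e c c' ih ih' =>
    obtain ⟨p, hp⟩ := e.exists_cost_polynomial
    obtain ⟨q, hq⟩ := ih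
    obtain ⟨r, hr⟩ := ih'
    exact ⟨p + q + r + 1, fun n => by simp [Cmd.cost, hp, hq, hr]⟩
  | loop b x c ih =>
    obtain ⟨p, hp⟩ := ih
    exact ⟨2 * X * (p + 6) + 3, fun n => by simp [Cmd.cost, hp]⟩

/-! ### Total correctness with time bounds -/

/-- Total correctness with a time bound, for programs that act on states of the variables. -/
def Triple (n : ℕ) (pre : State → Prop) (P : Program) (post : State → Prop) (T : ℕ) : Prop :=
  ∀ s σ, Represents n s σ → pre σ →
    ∃ s' σ' t, Runs P s s' t ∧ t ≤ T ∧ Represents n s' σ' ∧ post σ'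

theorem Triple.cmd {n : ℕ} {pre post : State → Prop} (c : Cmd)
    (h : ∀ σ, pre σ → post (c.eval n σ)) : Triple n pre (c.compile 0) post (c.cost n) := by
  intro s σ hs hσ
  obtain ⟨s', t, r, ht, h', _⟩ := c.compile_runs n 0 hs
  exact ⟨s', _, t, r, ht, h', h σ hσ⟩

theorem Triple.seq {n : ℕ} {pre mid post : State → Prop} {P Q : Program} {T T' : ℕ}
    (h : Triple n pre P mid T) (h' : Triple n mid Q post T') :
    Triple n pre (.seq P Q) post (T + T') := by
  intro s σ hs hσ
  obtain ⟨s₁, σ₁, t₁, r₁, ht₁, g₁, q₁⟩ := h s σ hs hσ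
  obtain ⟨s₂, σ₂, t₂, r₂, ht₂, g₂, q₂⟩ := h' s₁ σ₁ g₁ q₁
  exact ⟨s₂, σ₂, _, .seq r₁ r₂, by omega, g₂, q₂⟩

theorem Triple.mono {n : ℕ} {pre pre' post post' : State → Prop} {P : Program} {T T' : ℕ}
    (h : Triple n pre P post T) (hpre : ∀ σ, pre' σ → pre σ) (hpost : ∀ σ, post σ → post' σ)
    (hT : T ≤ T') : Triple n pre' P post' T' := by
  intro s σ hs hσ
  obtain ⟨s₁, σ₁, t₁, r₁, ht₁, g₁, q₁⟩ := h s σ hs (hpre σ hσ)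
  exact ⟨s₁, σ₁, t₁, r₁, by omega, g₁, hpost _ q₁⟩

/-- A loop on variable `v` that makes `N` passes, the `j`-th one in time `T j`. -/
theorem Triple.loop {n : ℕ} {v N : ℕ} {P : Program} (I : ℕ → State → Prop) {T : ℕ → ℕ}
    (hpos : ∀ j σ, j < N → I j σ → σ.reg v ≠ 0) (hzero : ∀ σ, I N σ → σ.reg v = 0)
    (h : ∀ j < N, Triple n (I j) P (I (j + 1)) (T j)) :
    Triple n (I 0) (.loop (2 * v + 5) P) (I N) (∑ j ∈ Finset.range N, (T j + 1) + 1) := by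
  -- Induction on the number `m` of passes that remain, since the loop unfolds from its first pass.
  have key : ∀ m ≤ N, Triple n (I (N - m)) (.loop (2 * v + 5) P) (I N)
      (∑ j ∈ Finset.Ico (N - m) N, (T j + 1) + 1) := by
    intro m
    induction m with
    | zero =>
      intro _ s σ hs hσ
      exact ⟨s, σ, 1, .loop_exit (by rw [hs.var]; exact hzero σ hσ), by omega, hs, hσ⟩
    | succ m ih =>
      intro hm s σ hs hσ
      have e : N - (m + 1) + 1 = N - m := by omega
      obtain ⟨s₁, σ₁, t₁, r₁, ht₁, g₁, q₁⟩ := h (N - (m + 1)) (by omega) s σ hs hσ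
      rw [e] at q₁
      obtain ⟨s₂, σ₂, t₂, r₂, ht₂, g₂, q₂⟩ := ih (by omega) s₁ σ₁ g₁ q₁
      refine ⟨s₂, σ₂, _, .loop_step (by rw [hs.var]; exact hpos _ σ (by omega) hσ) r₁ r₂, ?_,
        g₂, q₂⟩
      rw [← Finset.sum_Ioo_add_eq_sum_Ico (by omega : N - (m + 1) < N)]
      have : Finset.Ioo (N - (m + 1)) N = Finset.Ico (N - m) N := by
        ext x; simp only [Finset.mem_Ioo, Finset.mem_Ico]; omega
      rw [this]
      omega
  have := key N le_rfl
  rwa [Nat.sub_self, ← Finset.range_eq_Ico] at this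

end RAM

/-! ### Bit strings that guide covers and colourings -/

namespace RAM

theorem iter_induction {α : Type*} {f : ℕ → α → α} {n : ℕ} (p : ℕ → α → Prop)
    (h : ∀ i a, i < n → p i a → p (i + 1) (f i a)) {a : α} (h0 : p 0 a) : p n (iter f n a) := by
  induction n with
  | zero => exact h0
  | succ n ih => exact h n _ (by omega) (ih fun i a hi => h i a (by omega))

theorem iter_simulation {α β : Type*} {f : ℕ → α → α} {g : ℕ → β → β} {n : ℕ}
    (R : α → β → Prop) (h : ∀ i a b, i < n → R a b → R (f i a) (g i b)) {a : α} {b : β}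
    (h0 : R a b) : R (iter f n a) (iter g n b) := by
  induction n with
  | zero => exact h0
  | succ n ih => exact h n _ _ (by omega) (ih fun i a b hi => h i a b (by omega))

/-- Bit strings of length `k` are read off a number `u < 2 ^ k`, the leading bit first. `Code k m u`
says that only the first `m` of them can be nonzero. -/
def Code (k m u : ℕ) : Prop := ∃ j < 2 ^ m, u = j * 2 ^ (k - m)

theorem Code.lt {k m u : ℕ} (h : Code k m u) (hm : m ≤ k) : u < 2 ^ k := by
  obtain ⟨j, hj, rfl⟩ := h
  calc j * 2 ^ (k - m) < 2 ^ m * 2 ^ (k - m) := by gcongr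
    _ = 2 ^ k := by rw [← pow_add]; congr 1; omega

theorem code_zero (k : ℕ) : Code k 0 0 := ⟨0, by simp, by simp⟩

/-- This undoes the reading of a bit, which doubles the number and subtracts `2 ^ k` on overflow.
Since `m < k`, the last bit of `u` is `0` and nothing is lost in the shift to the right. -/
theorem Code.prepend {k m u : ℕ} (h : Code k m u) (hm : m < k) (p : Prop) [Decidable p] :
    ∃ u', Code k (m + 1) u' ∧ u' + u' = u + if p then 2 ^ k else 0 := by
  obtain ⟨j, hj, rfl⟩ := h
  have e : k - m = k - (m + 1) + 1 := by omega
  have e' : 2 ^ k = 2 ^ m * 2 ^ (k - m) := by rw [← pow_add]; congr 1; omega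
  refine ⟨(j + if p then 2 ^ m else 0) * 2 ^ (k - (m + 1)), ⟨_, ?_, rfl⟩, ?_⟩
  · rw [pow_succ]; split <;> omega
  · rw [e', e, pow_succ]; split <;> ring

open Classical in
/-- If the pair `a`, `b` is an uncovered edge, one of `a` and `b` is added to the cover, as the next
bit says. A state consists of a set of vertices, a counter, and the bits not read yet. -/
noncomputable def coverStep (A : ℕ → ℕ → Prop) (K a b : ℕ) (st : Finset ℕ × ℕ × ℕ) :
    Finset ℕ × ℕ × ℕ :=
  if A a b ∧ a ∉ st.1 ∧ b ∉ st.1 then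
    if st.2.2 + st.2.2 < K then (insert b st.1, st.2.1 + 1, st.2.2 + st.2.2)
    else (insert a st.1, st.2.1 + 1, st.2.2 + st.2.2 - K)
  else st

/-- The vertex cover that is found greedily, guided by the bits of `u`. -/
noncomputable def cover (n : ℕ) (A : ℕ → ℕ → Prop) (K u : ℕ) : Finset ℕ × ℕ × ℕ :=
  iter (fun a => iter (coverStep A K a) n) n (∅, 0, u)

theorem coverStep_subset (A : ℕ → ℕ → Prop) (K a b : ℕ) (st : Finset ℕ × ℕ × ℕ) :
    st.1 ⊆ (coverStep A K a b st).1 := by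
  unfold coverStep
  split_ifs
  · exact Finset.subset_insert _ _
  · exact Finset.subset_insert _ _
  · exact subset_rfl

theorem coverStep_covers (A : ℕ → ℕ → Prop) (K a b : ℕ) (st : Finset ℕ × ℕ × ℕ) (h : A a b) :
    a ∈ (coverStep A K a b st).1 ∨ b ∈ (coverStep A K a b st).1 := by
  unfold coverStep
  split_ifs with h1 h2
  · simp
  · simp
  · by_contra! h3
    exact h1 ⟨h, h3⟩

theorem coverStep_small {n : ℕ} {A : ℕ → ℕ → Prop} (hA : ∀ a b, A a b → a < n ∧ b < n)
    (K a b : ℕ) (st : Finset ℕ × ℕ × ℕ) (h : st.1.card ≤ st.2.1 ∧ ∀ v ∈ st.1, v < n) :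
    (coverStep A K a b st).1.card ≤ (coverStep A K a b st).2.1 ∧
      ∀ v ∈ (coverStep A K a b st).1, v < n := by
  unfold coverStep
  split_ifs with h1 h2
  · refine ⟨(Finset.card_insert_le _ _).trans (by simpa using h.1), fun v hv => ?_⟩
    rcases Finset.mem_insert.1 hv with rfl | hv
    exacts [(hA _ _ h1.1).2, h.2 v hv]
  · refine ⟨(Finset.card_insert_le _ _).trans (by simpa using h.1), fun v hv => ?_⟩
    rcases Finset.mem_insert.1 hv with rfl | hv
    exacts [(hA _ _ h1.1).1, h.2 v hv]
  · exact h

theorem cover_small {n : ℕ} {A : ℕ → ℕ → Prop} (hA : ∀ a b, A a b → a < n ∧ b < n) (K u : ℕ) :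
    (cover n A K u).1.card ≤ (cover n A K u).2.1 ∧ ∀ v ∈ (cover n A K u).1, v < n :=
  iter_induction (fun _ (st : Finset ℕ × ℕ × ℕ) => st.1.card ≤ st.2.1 ∧ ∀ v ∈ st.1, v < n)
    (fun a _ _ h => iter_induction (fun _ (st : Finset ℕ × ℕ × ℕ) => st.1.card ≤ st.2.1 ∧ ∀ v ∈ st.1, v < n)
      (fun b st _ h => coverStep_small hA K a b st h) h) ⟨le_rfl, by simp⟩

/-- The set only grows, and the step at the pair `a`, `b` leaves this pair covered. So every string
yields a vertex cover; the bits matter only for its size. -/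
theorem cover_covers {n : ℕ} {A : ℕ → ℕ → Prop} (hA : ∀ a b, A a b → a < n ∧ b < n) (K u : ℕ)
    {a b : ℕ} (h : A a b) : a ∈ (cover n A K u).1 ∨ b ∈ (cover n A K u).1 := by
  refine iter_induction (f := fun a => iter (coverStep A K a) n) (n := n)
    (fun i st => ∀ a < i, ∀ b < n, A a b → a ∈ st.1 ∨ b ∈ st.1)
    (fun i st _ hst => ?_) (fun _ h => absurd h (by omega)) a (hA a b h).1 b (hA a b h).2 h
  have := iter_induction (f := coverStep A K i) (n := n)
    (fun j st' => st.1 ⊆ st'.1 ∧ ∀ b < j, A i b → i ∈ st'.1 ∨ b ∈ st'.1)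
    (fun j st' _ hst' => by
      refine ⟨hst'.1.trans (coverStep_subset _ _ _ _ _), fun b hb hab => ?_⟩
      rcases Nat.lt_succ_iff_lt_or_eq.1 hb with hb | rfl
      · exact (hst'.2 b hb hab).imp (fun h => coverStep_subset _ _ _ _ _ h)
          fun h => coverStep_subset _ _ _ _ _ h
      · exact coverStep_covers _ _ _ _ _ hab)
    (a := st) ⟨subset_rfl, fun _ h => absurd h (by omega)⟩
  intro a ha b hb hab
  rcases Nat.lt_succ_iff_lt_or_eq.1 ha with ha | rfl
  · exact (hst a ha b hb hab).imp (fun h => this.1 h) fun h => this.1 h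
  · exact this.2 b hb hab

/-- With suitable bits, `f` enlarges the set inside `C` and counts correctly. -/
def Guided (k : ℕ) (C : Finset ℕ) (f : Finset ℕ × ℕ × ℕ → Finset ℕ × ℕ × ℕ) : Prop :=
  ∀ X ⊆ C, ∃ X' ⊆ C, ∃ d, X'.card = X.card + d ∧ ∀ m u, Code k m u → m + d ≤ k →
    ∃ u', Code k (m + d) u' ∧ ∀ i, f (X, i, u') = (X', i + d, u)

/-- The sets are determined forwards, the bits backwards: steps read from the front of the string,
so the bits for the last step are prepended first. This works because `X'` and `d` do not depend on
the string that is left over. -/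
theorem Guided.iter {k : ℕ} {C : Finset ℕ} {f : ℕ → Finset ℕ × ℕ × ℕ → Finset ℕ × ℕ × ℕ}
    (h : ∀ i, Guided k C (f i)) (n : ℕ) : Guided k C (iter f n) := by
  induction n with
  | zero => exact fun X hX => ⟨X, hX, 0, rfl, fun m u hu _ => ⟨u, hu, fun i => rfl⟩⟩
  | succ n ih =>
    intro X hX
    obtain ⟨X₁, hX₁, d₁, hd₁, h₁⟩ := ih X hX
    obtain ⟨X₂, hX₂, d₂, hd₂, h₂⟩ := h n X₁ hX₁
    refine ⟨X₂, hX₂, d₁ + d₂, by omega, fun m u hu hm => ?_⟩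
    obtain ⟨u₁, hu₁, e₁⟩ := h₂ m u hu (by omega)
    obtain ⟨u₂, hu₂, e₂⟩ := h₁ (m + d₂) u₁ hu₁ (by omega)
    refine ⟨u₂, by rwa [show m + (d₁ + d₂) = m + d₂ + d₁ by omega], fun i => ?_⟩
    rw [RAM.iter, e₂, e₁, add_assoc]

/-- An uncovered edge has an end in `C`, and the bit that selects this end keeps the set inside `C`.
-/
theorem guided_coverStep {A : ℕ → ℕ → Prop} {C : Finset ℕ} (hC : ∀ a b, A a b → a ∈ C ∨ b ∈ C)
    (k a b : ℕ) : Guided k C (coverStep A (2 ^ k) a b) := by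
  classical
  intro X hX
  by_cases h : A a b ∧ a ∉ X ∧ b ∉ X
  · by_cases ha : a ∈ C
    · refine ⟨insert a X, Finset.insert_subset ha hX, 1, Finset.card_insert_of_notMem h.2.1,
        fun m u hu hm => ?_⟩
      obtain ⟨u', hu', e⟩ := hu.prepend (by omega) True
      rw [if_pos trivial] at e
      refine ⟨u', hu', fun i => ?_⟩
      rw [coverStep, if_pos h, if_neg (by simp only; omega)]
      simp only [Prod.mk.injEq, true_and]
      omega
    · refine ⟨insert b X, Finset.insert_subset ((hC a b h.1).resolve_left ha) hX, 1,
        Finset.card_insert_of_notMem h.2.2, fun m u hu hm => ?_⟩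
      obtain ⟨u', hu', e⟩ := hu.prepend (by omega) False
      rw [if_neg id] at e
      have := hu.lt (by omega)
      refine ⟨u', hu', fun i => ?_⟩
      rw [coverStep, if_pos h, if_pos (by simp only; omega)]
      simp only [Prod.mk.injEq, true_and]
      omega
  · refine ⟨X, hX, 0, rfl, fun m u hu _ => ⟨u, hu, fun i => ?_⟩⟩
    rw [coverStep, if_neg h, add_zero]

/-- Started from the empty set, the guided run stays inside `C`, so it makes `d ≤ C.card ≤ k`
insertions and needs at most `k` bits. -/
theorem exists_cover_le {n k : ℕ} {A : ℕ → ℕ → Prop} {C : Finset ℕ}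
    (hC : ∀ a b, A a b → a ∈ C ∨ b ∈ C) (hk : C.card ≤ k) :
    ∃ u < 2 ^ k, (cover n A (2 ^ k) u).2.1 ≤ k := by
  obtain ⟨X, hX, d, hd, h⟩ := Guided.iter
    (fun a => Guided.iter (fun b => guided_coverStep hC k a b) n) n ∅ (by simp)
  have := Finset.card_le_card hX
  rw [Finset.card_empty] at hd
  obtain ⟨u, hu, e⟩ := h 0 0 (code_zero k) (by omega)
  refine ⟨u, hu.lt (by omega), ?_⟩
  rw [cover, e]
  simp only
  omega

open Classical in
/-- If `v` is in `X`, the next bit says whether `v` is put into the set of coloured vertices. -/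
noncomputable def colourStep (X : Finset ℕ) (K v : ℕ) (st : Set ℕ × ℕ) : Set ℕ × ℕ :=
  if v ∈ X then
    if st.2 + st.2 < K then (st.1 \ {v}, st.2 + st.2) else (insert v st.1, st.2 + st.2 - K)
  else st

/-- One bit is read per vertex of `X`, in increasing order, so `k` bits suffice to produce any
colouring of `X`. The initial set `Y` is irrelevant because every vertex of `X` is written. -/
theorem exists_colour {n k : ℕ} {X : Finset ℕ} (hX : ∀ v ∈ X, v < n) (hk : X.card ≤ k)
    (χ : Set ℕ) (Y : Set ℕ) :
    ∃ u < 2 ^ k, ∀ v ∈ X, v ∈ (iter (colourStep X (2 ^ k)) n (Y, u)).1 ↔ v ∈ χ := by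
  classical
  have key : ∀ N m u, Code k m u → m + (X.filter (· < N)).card ≤ k →
      ∃ u', Code k (m + (X.filter (· < N)).card) u' ∧
        (iter (colourStep X (2 ^ k)) N (Y, u')).2 = u ∧
        ∀ v ∈ X, v < N → (v ∈ (iter (colourStep X (2 ^ k)) N (Y, u')).1 ↔ v ∈ χ) := by
    intro N
    induction N with
    | zero => exact fun m u hu _ => ⟨u, by simpa using hu, rfl, fun _ _ h => absurd h (by omega)⟩
    | succ N ih =>
      intro m u hu hm
      by_cases hN : N ∈ X
      · have e : (X.filter (· < N + 1)) = insert N (X.filter (· < N)) := by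
          ext v
          simp only [Finset.mem_filter, Finset.mem_insert]
          constructor
          · rintro ⟨h1, h2⟩
            by_cases h : v = N
            · exact .inl h
            · exact .inr ⟨h1, by omega⟩
          · rintro (rfl | ⟨h1, h2⟩)
            exacts [⟨hN, by omega⟩, ⟨h1, by omega⟩]
        rw [e, Finset.card_insert_of_notMem (by simp)] at hm ⊢
        -- Vertex `N` is treated last, so its bit goes in front of `u` before the bits of the
        -- smaller vertices are prepended.
        obtain ⟨u₁, hu₁, e₁⟩ := hu.prepend (by omega) (N ∈ χ)
        obtain ⟨u₂, hu₂, e₂, h₂⟩ := ih (m + 1) u₁ hu₁ (by omega)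
        refine ⟨u₂, by rwa [show ∀ q, m + (q + 1) = m + 1 + q by omega], ?_⟩
        generalize hst : RAM.iter (colourStep X (2 ^ k)) N (Y, u₂) = st at e₂ h₂
        rw [RAM.iter, hst, colourStep, if_pos hN, e₂]
        have := hu.lt (by omega)
        split_ifs at e₁ ⊢ with h3 h4 h4
        · omega
        · refine ⟨by simp only; omega, fun v hv hvN => ?_⟩
          by_cases hvn : v = N
          · simp [hvn, h4]
          · simpa [hvn] using h₂ v hv (by omega)
        · refine ⟨by simp only; omega, fun v hv hvN => ?_⟩
          by_cases hvn : v = N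
          · simp [hvn, h4]
          · simpa [hvn] using h₂ v hv (by omega)
        · omega
      · have e : (X.filter (· < N + 1)) = X.filter (· < N) := by
          ext v
          simp only [Finset.mem_filter]
          refine and_congr_right fun h => ⟨fun h' => ?_, fun h' => by omega⟩
          rcases Nat.lt_succ_iff_lt_or_eq.1 h' with h' | rfl
          exacts [h', absurd h hN]
        rw [e] at hm ⊢
        obtain ⟨u₂, hu₂, e₂, h₂⟩ := ih m u hu hm
        refine ⟨u₂, hu₂, ?_⟩
        rw [RAM.iter, colourStep, if_neg hN]
        refine ⟨e₂, fun v hv hvN => h₂ v hv ?_⟩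
        rcases Nat.lt_succ_iff_lt_or_eq.1 hvN with h' | rfl
        exacts [h', absurd hv hN]
  have hle := Finset.card_le_card (Finset.filter_subset (· < n) X)
  obtain ⟨u, hu, -, h⟩ := key n 0 0 (code_zero k) (by omega)
  exact ⟨u, hu.lt (by omega), fun v hv => h v hv (hX v hv)⟩

/-! ### Transitive closure and 2-satisfiability -/

/-- Warshall's algorithm: paths of `E` whose inner vertices are below `k`. -/
def warshall (E : ℕ → ℕ → Prop) : ℕ → ℕ → ℕ → Prop
  | 0, i, j => E i j
  | k + 1, i, j => warshall E k i j ∨ warshall E k i k ∧ warshall E k k j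

/-- If both paths pass through the largest admitted inner vertex, the detour between the two visits
is cut out. Once `k` exceeds all vertices, the relation is transitive. -/
theorem warshall_trans {E : ℕ → ℕ → Prop} {k i m j : ℕ} (h : warshall E k i m)
    (h' : warshall E k m j) (hm : m < k) : warshall E k i j := by
  induction k generalizing i m j with
  | zero => omega
  | succ k ih =>
    rcases Nat.lt_succ_iff_lt_or_eq.1 hm with hm | rfl
    · rcases h with h | h <;> rcases h' with h' | h'
      · exact .inl (ih h h' hm)
      · exact .inr ⟨ih h h'.1 hm, h'.2⟩
      · exact .inr ⟨h.1, ih h.2 h' hm⟩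
      · exact .inr ⟨h.1, h'.2⟩
    · exact .inr ⟨h.elim id (·.1), h'.elim id (·.2)⟩

theorem le_warshall {E : ℕ → ℕ → Prop} {k i j : ℕ} (h : E i j) : warshall E k i j := by
  induction k with
  | zero => exact h
  | succ k ih => exact .inl ih

theorem warshall_le {E T : ℕ → ℕ → Prop} (hE : ∀ i j, E i j → T i j)
    (hT : ∀ i j m, T i j → T j m → T i m) {k i j : ℕ} (h : warshall E k i j) : T i j := by
  induction k generalizing i j with
  | zero => exact hE i j h
  | succ k ih => exact h.elim ih fun h => hT _ _ _ (ih h.1) (ih h.2)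

/-- The combinatorial core of 2-satisfiability: if the implication relation `T` on literals relates
no literal to its negation in both directions, then some truth assignment respects it. -/
theorem exists_assignment {Λ : Type*} {neg : Λ → Λ} {T : Λ → Λ → Prop}
    (hneg : ∀ l, neg (neg l) = l) (trans : ∀ i j m, T i j → T j m → T i m)
    (skew : ∀ l m, T l m → T (neg m) (neg l))
    (h : ∀ l, neg l ≠ l → ¬ (T l (neg l) ∧ T (neg l) l)) :
    ∃ S : Set Λ, (∀ l ∈ S, neg l ∉ S) ∧ (∀ l, neg l ≠ l → l ∈ S ∨ neg l ∈ S) ∧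
      ∀ l ∈ S, ∀ m, T l m → m ∈ S := by
  -- A maximal set of literals that is free of contradictions and closed under `T` turns out to
  -- decide every literal that `neg` does not fix.
  obtain ⟨S, hS⟩ := zorn_subset
    {S : Set Λ | (∀ l ∈ S, neg l ∉ S) ∧ ∀ l ∈ S, ∀ m, T l m → m ∈ S} (by
      intro c hc hchain
      refine ⟨⋃₀ c, ⟨?_, ?_⟩, fun s hs => Set.subset_sUnion_of_mem hs⟩
      · rintro l ⟨s, hs, hl⟩ ⟨t, ht, hl'⟩
        rcases hchain.total hs ht with hst | hst
        · exact (hc ht).1 l (hst hl) hl'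
        · exact (hc hs).1 l hl (hst hl')
      · rintro l ⟨s, hs, hl⟩ m hm
        exact ⟨s, hs, (hc hs).2 l hl m hm⟩)
  -- Adding `l` and its consequences would create no contradiction: a consequence whose negation
  -- lies in `S` would by `skew` put `neg l` into `S`, and two opposite consequences would give `T l
  -- (neg l)`. This violates maximality.
  have extend : ∀ l, l ∉ S → neg l ∉ S → neg l ≠ l → ¬ T l (neg l) → False := by
    intro l h1 h2 h3 h4
    refine h1 (hS.2 (y := S ∪ {m | m = l ∨ T l m}) ⟨?_, ?_⟩ Set.subset_union_left
      (.inr (.inl rfl)))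
    · have aux : ∀ m, (m = l ∨ T l m) → neg m ∉ S := by
        rintro m (rfl | hm) hm'
        · exact h2 hm'
        · exact h2 (hS.1.2 _ hm' _ (skew _ _ hm))
      rintro m (hm | hm) (hm' | hm')
      · exact hS.1.1 m hm hm'
      · exact aux _ hm' (by rwa [hneg])
      · exact aux _ hm hm'
      · rcases hm with rfl | hm
        · exact hm'.elim h3 h4
        · rcases hm' with hm' | hm'
          · rw [← hm', hneg] at h4
            exact h4 (hm' ▸ hm)
          · have := skew _ _ hm'
            rw [hneg] at this
            exact h4 (trans _ _ _ hm this)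
    · rintro m (hm | hm) m' hm'
      · exact .inl (hS.1.2 m hm m' hm')
      · rcases hm with rfl | hm
        exacts [.inr (.inr hm'), .inr (.inr (trans _ _ _ hm hm'))]
  refine ⟨S, hS.1.1, fun l hl => ?_, hS.1.2⟩
  by_contra! h'
  -- If `l` implies its negation, then by `h` the converse fails, and `neg l` can be added instead.
  by_cases h4 : T l (neg l)
  · refine extend (neg l) h'.2 (by rw [hneg]; exact h'.1) (by rw [hneg]; exact hl.symm) ?_
    rw [hneg]
    exact fun h5 => h l hl ⟨h4, h5⟩
  · exact extend l h'.1 h'.2 hl h4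

end RAM

/-! ### Extending a colouring of a vertex cover -/

namespace ConflictFreeCut

/-- The literal `l < n` says that vertex `l` is coloured, and the literal `n + v` that `v` is not
coloured. -/
def litNeg (n l : ℕ) : ℕ := if l < n then l + n else if l < n + n then l - n else l

/-- The vertex of a literal. -/
def litVar (n l : ℕ) : ℕ := if l < n then l else l - n

theorem litNeg_litNeg (n l : ℕ) : litNeg n (litNeg n l) = l := by
  unfold litNeg; split_ifs <;> omega

/-- The implications of the 2-satisfiability instance for the colourings that extend the colouring
`col` of the vertex cover `X`, colour `w` and do not colour `w'`. -/
def Implies (n : ℕ) (C : ℕ → ℕ → ℕ → ℕ → Prop) (X col : ℕ → Prop) (w w' l m : ℕ) : Prop :=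
  l < n + n ∧ m < n + n ∧
    (m = litNeg n l ∧ (X (litVar n m) ∧ (m < n ↔ col (litVar n m)) ∨ m = w ∨ m = w' + n) ∨
    ∃ u x, X u ∧ X x ∧ C u (litVar n l) x (litVar n m) ∧ (l < n ↔ ¬ col u) ∧ (m < n ↔ col x))

/-- The test of the algorithm: no literal and its negation imply each other. -/
def Consistent (n : ℕ) (C : ℕ → ℕ → ℕ → ℕ → Prop) (X col : ℕ → Prop) (w w' : ℕ) : Prop :=
  ∀ l < n + n, ¬ (RAM.warshall (Implies n C X col w w') (n + n) l (litNeg n l) ∧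
    RAM.warshall (Implies n C X col w w') (n + n) (litNeg n l) l)

/-- Let `u` and `x` be ends in `X` of two edges in conflict. A literal that gives the other end of
the first edge the colour opposite to that of `u` makes this edge bichromatic, so the other end of
the second edge must agree with `x`: an implication between literals. A forced literal enters as the
implication from its negation to itself. Interchanging the two edges gives the contrapositive, so
`exists_assignment` applies. -/
theorem consistent_iff {n : ℕ} {C : ℕ → ℕ → ℕ → ℕ → Prop} {X col : ℕ → Prop} {w w' : ℕ}
    (hsymm : ∀ u v x y, C u v x y → C x y u v) (hswap : ∀ u v x y, C u v x y → C v u x y)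
    (hlt : ∀ u v x y, C u v x y → u < n) (hX : ∀ u v x y, C u v x y → X u ∨ X v)
    (hXn : ∀ v, X v → v < n) (hw : w < n) (hw' : w' < n) :
    Consistent n C X col w w' ↔ ∃ χ : ℕ → Prop, (∀ v, X v → (χ v ↔ col v)) ∧ χ w ∧ ¬ χ w' ∧
      ∀ u v x y, C u v x y → (χ u ↔ χ v) ∨ (χ x ↔ χ y) := by
  have negE : ∀ l, l < n + n → litNeg n l < n + n := fun l h => by unfold litNeg; split_ifs <;> omega
  have negV : ∀ l, l < n + n → litVar n (litNeg n l) = litVar n l := fun l h => by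
    unfold litNeg litVar; split_ifs <;> omega
  have negL : ∀ l, l < n + n → (litNeg n l < n ↔ ¬ l < n) := fun l h => by
    unfold litNeg; split_ifs <;> omega
  constructor
  · intro h
    set E := Implies n C X col w w' with hE
    have Elt : ∀ l m, E l m → l < n + n ∧ m < n + n := fun l m h => ⟨h.1, h.2.1⟩
    have Eskew : ∀ l m, E l m → E (litNeg n m) (litNeg n l) := by
      rintro l m ⟨hl, hm, hlm⟩
      refine ⟨negE m hm, negE l hl, ?_⟩
      rcases hlm with ⟨e, hU⟩ | ⟨u, x, hu, hx, hC, h1, h2⟩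
      · exact .inl ⟨by rw [e, litNeg_litNeg], by rwa [e] at hU⟩
      · refine .inr ⟨x, u, hx, hu, ?_, ?_, ?_⟩
        · rw [negV l hl, negV m hm]
          exact hsymm _ _ _ _ hC
        · rw [negL m hm, h2]
        · rw [negL l hl, h1, not_not]
    have Wlt : ∀ l m, RAM.warshall E (n + n) l m → l < n + n ∧ m < n + n := fun l m h =>
      RAM.warshall_le (T := fun l m => l < n + n ∧ m < n + n) Elt
        (fun i j m h h' => ⟨h.1, h'.2⟩) h
    have Wtrans : ∀ i j m, RAM.warshall E (n + n) i j → RAM.warshall E (n + n) j m →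
        RAM.warshall E (n + n) i m := fun i j m h h' => RAM.warshall_trans h h' (Wlt _ _ h).2
    have Wskew : ∀ l m, RAM.warshall E (n + n) l m →
        RAM.warshall E (n + n) (litNeg n m) (litNeg n l) := fun l m h =>
      RAM.warshall_le (T := fun l m => RAM.warshall E (n + n) (litNeg n m) (litNeg n l))
        (fun i j h => RAM.le_warshall (Eskew i j h)) (fun i j m h h' => Wtrans _ _ _ h' h) h
    -- The numbers from `2 * n` on are fixed by `litNeg` and drop out of the criterion.
    obtain ⟨S, hS1, hS2, hS3⟩ := RAM.exists_assignment (litNeg_litNeg n) Wtrans Wskew (by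
      intro l hl
      refine h l ?_
      by_contra hl'
      exact hl (by unfold litNeg; split_ifs <;> omega))
    have tot : ∀ l < n + n, (l ∈ S ↔ litNeg n l ∉ S) := fun l hl =>
      ⟨hS1 l, fun h => (hS2 l (by unfold litNeg; split_ifs <;> omega)).resolve_right h⟩
    have unit : ∀ m < n + n, (X (litVar n m) ∧ (m < n ↔ col (litVar n m)) ∨ m = w ∨ m = w' + n) →
        m ∈ S := by
      intro m hm hU
      rw [tot m hm]
      intro h'
      refine hS1 _ h' ?_
      rw [litNeg_litNeg]
      exact hS3 _ h' _ (RAM.le_warshall ⟨negE m hm, hm, .inl ⟨(litNeg_litNeg n m).symm, hU⟩⟩)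
    have plain : ∀ v < n, litVar n v = v ∧ litVar n (v + n) = v ∧ litNeg n v = v + n ∧
        litNeg n (v + n) = v := fun v hv => by
      unfold litVar litNeg; split_ifs <;> omega
    have hcol : ∀ v, X v → (v ∈ S ↔ col v) := by
      intro v hv
      have hvn := hXn v hv
      obtain ⟨p1, p2, p3, p4⟩ := plain v hvn
      by_cases hc : col v
      · exact ⟨fun _ => hc, fun _ => unit v (by omega) (.inl (by simp [p1, hv, hvn, hc]))⟩
      · refine ⟨fun h' => ?_, fun h' => absurd h' hc⟩
        have := unit (v + n) (by omega) (.inl (by simp [p2, hv, hc]))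
        rw [tot v (by omega), p3] at h'
        exact absurd this h'
    refine ⟨(· ∈ S), hcol, unit w (by omega) (.inr (.inl rfl)), ?_, ?_⟩
    · have := unit (w' + n) (by omega) (.inr (.inr rfl))
      rw [tot _ (by omega), (plain w' hw').2.2.2] at this
      exact this
    -- If the edge `u v` is bichromatic, the literal that sets `v` against `u` is in `S`, and
    -- closure puts the literal that makes `y` agree with `x` into `S`.
    · have main : ∀ u v x y, C u v x y → X u → X x → (u ∈ S ↔ v ∈ S) ∨ (x ∈ S ↔ y ∈ S) := by
        intro u v x y hC hu hx
        rw [or_iff_not_imp_left]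
        intro huv
        have hv : v < n := hlt _ _ _ _ (hswap _ _ _ _ hC)
        have hy : y < n := hlt _ _ _ _ (hswap _ _ _ _ (hsymm _ _ _ _ hC))
        obtain ⟨p1, p2, p3, p4⟩ := plain v hv
        obtain ⟨q1, q2, q3, q4⟩ := plain y hy
        rw [hcol u hu] at huv
        rw [hcol x hx]
        by_cases hcu : col u <;> by_cases hcx : col x
        · have hvS : v + n ∈ S := by
            rw [tot _ (by omega), p4]; tauto
          have := hS3 _ hvS y (RAM.le_warshall ⟨by omega, by omega,
            .inr ⟨u, x, hu, hx, by rwa [p2, q1], by simp [hcu], by simp [hcx, hy]⟩⟩)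
          tauto
        · have hvS : v + n ∈ S := by
            rw [tot _ (by omega), p4]; tauto
          have := hS3 _ hvS (y + n) (RAM.le_warshall ⟨by omega, by omega,
            .inr ⟨u, x, hu, hx, by rwa [p2, q2], by simp [hcu], by simp [hcx]⟩⟩)
          rw [tot _ (by omega), q4] at this
          tauto
        · have hvS : v ∈ S := by tauto
          have := hS3 _ hvS y (RAM.le_warshall ⟨by omega, by omega,
            .inr ⟨u, x, hu, hx, by rwa [p1, q1], by simp [hcu, hv], by simp [hcx, hy]⟩⟩)
          tauto
        · have hvS : v ∈ S := by tauto
          have := hS3 _ hvS (y + n) (RAM.le_warshall ⟨by omega, by omega,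
            .inr ⟨u, x, hu, hx, by rwa [p1, q2], by simp [hcu, hv], by simp [hcx]⟩⟩)
          rw [tot _ (by omega), q4] at this
          tauto
      -- Symmetry of conflicts and reversal of edges bring the covering ends into first position.
      have half : ∀ u v x y, C u v x y → X u → (u ∈ S ↔ v ∈ S) ∨ (x ∈ S ↔ y ∈ S) := by
        intro u v x y hC hu
        rcases hX _ _ _ _ (hsymm _ _ _ _ hC) with hx | hy
        · exact main u v x y hC hu hx
        · have := main u v y x (hsymm _ _ _ _ (hswap _ _ _ _ (hsymm _ _ _ _ hC))) hu hy
          tauto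
      intro u v x y hC
      rcases hX _ _ _ _ hC with hu | hv
      · exact half u v x y hC hu
      · have := half v u x y (hswap _ _ _ _ hC) hv
        tauto
  · rintro ⟨χ, hcol, hχ, hχ', hC⟩ l hl ⟨h1, h2⟩
    -- Truth of a literal under `χ`. Implications preserve it, and exactly one of a literal and its
    -- negation is true, so the two cannot imply each other.
    let val : ℕ → Prop := fun l => l < n ↔ χ (litVar n l)
    have sound : ∀ l m, RAM.warshall (Implies n C X col w w') (n + n) l m → val l → val m := by
      intro l m h
      refine RAM.warshall_le (T := fun l m => val l → val m) ?_ (fun i j m h h' => h' ∘ h) h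
      rintro l m ⟨hl, hm, ⟨-, hU⟩ | ⟨u, x, hu, hx, hcf, h3, h4⟩⟩ hval
      · rcases hU with ⟨h5, h6⟩ | rfl | rfl
        · simp only [val]
          rw [hcol _ h5]
          exact h6
        · simp [val, litVar, hw, hχ]
        · simp [val, litVar, hχ']
      · have := hC _ _ _ _ hcf
        rw [hcol u hu, hcol x hx] at this
        simp only [val] at hval ⊢
        tauto
    have s1 := sound _ _ h1
    have s2 := sound _ _ h2
    simp only [val] at s1 s2
    rw [negL l hl, negV l hl] at s1 s2
    tauto

/-! ### Cuts as 2-colourings -/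

/-- Adjacency in the input graph, for natural numbers. -/
def Instance.AdjNat (I : Instance) (u v : ℕ) : Prop :=
  ∃ (hu : u < I.n) (hv : v < I.n), I.G.Adj ⟨u, hu⟩ ⟨v, hv⟩

/-- Conflicts between edges of the input graph, for natural numbers. -/
def Instance.ConflictNat (I : Instance) (u v x y : ℕ) : Prop :=
  ∃ (hu : u < I.n) (hv : v < I.n) (hx : x < I.n) (hy : y < I.n),
    I.Conflicting ⟨u, hu⟩ ⟨v, hv⟩ ⟨x, hx⟩ ⟨y, hy⟩

theorem Instance.ConflictNat.symm {I : Instance} {u v x y : ℕ} (h : I.ConflictNat u v x y) :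
    I.ConflictNat x y u v := by
  obtain ⟨hu, hv, hx, hy, h, h', hc⟩ := h
  exact ⟨hx, hy, hu, hv, h', h, hc.symm⟩

theorem Instance.ConflictNat.swap {I : Instance} {u v x y : ℕ} (h : I.ConflictNat u v x y) :
    I.ConflictNat v u x y := by
  obtain ⟨hu, hv, hx, hy, h, h', hc⟩ := h
  refine ⟨hv, hu, hx, hy, h.symm, h', ?_⟩
  convert hc using 2
  exact Subtype.ext Sym2.eq_swap

theorem Instance.ConflictNat.adj {I : Instance} {u v x y : ℕ} (h : I.ConflictNat u v x y) :
    I.AdjNat u v := by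
  obtain ⟨hu, hv, hx, hy, h, h', hc⟩ := h
  exact ⟨hu, hv, h⟩

/-- A conflict-free cut is the same as a nonconstant 2-colouring of the vertices for which no two
bichromatic edges are in conflict. -/
theorem Instance.hasConflictFreeCut_iff (I : Instance) :
    I.HasConflictFreeCut ↔ ∃ w < I.n, ∃ w' < I.n, ∃ χ : ℕ → Prop, χ w ∧ ¬ χ w' ∧
      ∀ u v x y, I.ConflictNat u v x y → (χ u ↔ χ v) ∨ (χ x ↔ χ y) := by
  constructor
  · rintro ⟨F, hF, hind⟩
    -- `Connected` includes nonemptiness, which is guaranteed here, so its failure for `G - F` comes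
    -- from an unreachable pair.
    have hne : Nonempty (Fin I.n) := I.connected.nonempty
    have : ∃ a b, ¬ (I.G.deleteEdges (Subtype.val '' F)).Reachable a b := by
      by_contra! h
      exact hF ⟨h⟩
    obtain ⟨a, b, hab⟩ := this
    have step : ∀ u v : Fin I.n, ∀ h : I.G.Adj u v, (⟨s(u, v), h⟩ : I.G.edgeSet) ∉ F →
        ((I.G.deleteEdges (Subtype.val '' F)).Reachable a u ↔
          (I.G.deleteEdges (Subtype.val '' F)).Reachable a v) := by
      intro u v h hn
      have hadj : (I.G.deleteEdges (Subtype.val '' F)).Adj u v := by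
        rw [SimpleGraph.deleteEdges_adj]
        refine ⟨h, ?_⟩
        rintro ⟨e, he, he'⟩
        exact hn (by convert he; exact Subtype.ext he'.symm)
      exact ⟨fun h => h.trans hadj.reachable, fun h => h.trans hadj.symm.reachable⟩
    -- A vertex is coloured if it is reachable from `a`. Edges outside `F` are monochromatic, so any
    -- two bichromatic edges lie in the independent set `F`.
    refine ⟨a, a.2, b, b.2,
      fun v => ∃ hv : v < I.n, (I.G.deleteEdges (Subtype.val '' F)).Reachable a ⟨v, hv⟩,
      ⟨a.2, .refl _⟩, fun h => hab h.2, ?_⟩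
    rintro u v x y ⟨hu, hv, hx, hy, h, h', hc⟩
    simp only [hu, hv, hx, hy, exists_true_left]
    by_contra! hcon
    have h1 : (⟨s(⟨u, hu⟩, ⟨v, hv⟩), h⟩ : I.G.edgeSet) ∈ F := by
      by_contra h1
      have := step _ _ h h1
      tauto
    have h2 : (⟨s(⟨x, hx⟩, ⟨y, hy⟩), h'⟩ : I.G.edgeSet) ∈ F := by
      by_contra h2
      have := step _ _ h' h2
      tauto
    exact hind h1 h2 hc.ne hc
  · rintro ⟨w, hw, w', hw', χ, hχ, hχ', hC⟩
    -- The cut consists of all bichromatic edges; after their removal no walk changes colour.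
    refine ⟨{e | ∃ u v : Fin I.n, e.1 = s(u, v) ∧ χ u ∧ ¬ χ v}, ?_, ?_⟩
    · intro hcon
      have inv : ∀ u v : Fin I.n, (I.G.deleteEdges (Subtype.val ''
          {e : I.G.edgeSet | ∃ u v : Fin I.n, e.1 = s(u, v) ∧ χ u ∧ ¬ χ v})).Reachable u v →
          χ u → χ v := by
        rintro u v ⟨p⟩
        induction p with
        | nil => exact id
        | @cons a b c hab _ ih =>
          intro ha
          refine ih ?_
          by_contra hb
          rw [SimpleGraph.deleteEdges_adj] at hab
          exact hab.2 ⟨⟨s(a, b), hab.1⟩, ⟨a, b, rfl, ha, hb⟩, rfl⟩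
      exact hχ' (inv ⟨w, hw⟩ ⟨w', hw'⟩ (hcon.preconnected _ _) hχ)
    · rintro ⟨e, he⟩ ⟨u, v, rfl, hu, hv⟩ ⟨f, hf⟩ ⟨x, y, rfl, hx, hy⟩ - hadj
      have := hC u v x y ⟨u.2, v.2, x.2, y.2, he, hf, hadj⟩
      tauto

theorem Instance.exists_vertexCover (I : Instance) :
    ∃ C : Finset ℕ, C.card = I.vertexCoverNumber ∧ ∀ a b, I.AdjNat a b → a ∈ C ∨ b ∈ C := by
  classical
  obtain ⟨s, hs, hc⟩ := I.G.vertexCoverNum_exists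
  refine ⟨s.toFinset.map Fin.valEmbedding, ?_, ?_⟩
  · rw [Finset.card_map, Instance.vertexCoverNumber, ← hs, Set.encard_eq_coe_toFinset_card]
    rfl
  · rintro a b ⟨ha, hb, h⟩
    refine (hc h).imp (fun h => ?_) fun h => ?_ <;>
    · rw [Finset.mem_map]
      exact ⟨_, by simpa using h, rfl⟩

end ConflictFreeCut

/-! ### Conditions and protected storage -/

namespace RAM

/-- The expression `e`, read as a condition. -/
def Expr.Holds (n : ℕ) (e : Expr) (σ : State) : Prop := e.eval n σ ≠ 0

namespace Expr

def and (e e' : Expr) : Expr := .ite e e' (.lit 0)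
def or (e e' : Expr) : Expr := .add e e'
def not (e : Expr) : Expr := .sub (.lit 1) e
def iff (e e' : Expr) : Expr := .ite e e' e'.not
def lt (e e' : Expr) : Expr := .sub e' e
def eq (e e' : Expr) : Expr := (Expr.add (.sub e e') (.sub e' e)).not

variable {n : ℕ} {e e' e'' : Expr} {σ : State}

theorem holds_and : (e.and e').Holds n σ ↔ e.Holds n σ ∧ e'.Holds n σ := by
  simp only [Holds, and, eval]; split <;> simp_all

theorem holds_or : (e.or e').Holds n σ ↔ e.Holds n σ ∨ e'.Holds n σ := by
  simp only [Holds, or, eval]; omega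

theorem holds_not : e.not.Holds n σ ↔ ¬ e.Holds n σ := by
  simp only [Holds, not, eval]; omega

theorem holds_iff : (e.iff e').Holds n σ ↔ (e.Holds n σ ↔ e'.Holds n σ) := by
  simp only [Holds, iff, not, eval]; split <;> omega

theorem holds_lt : (e.lt e').Holds n σ ↔ e.eval n σ < e'.eval n σ := by
  simp only [Holds, lt, eval]; omega

theorem holds_eq : (e.eq e').Holds n σ ↔ e.eval n σ = e'.eval n σ := by
  simp only [Holds, eq, not, eval]; omega

theorem holds_load : (load e).Holds n σ ↔ σ.mem (e.eval n σ) ≠ 0 := Iff.rfl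

theorem holds_sum {b : Bool} {x : ℕ} :
    (sum b x e).Holds n σ ↔ ∃ i < bound n b, e.Holds n (σ.setReg x i) := by
  simp [Holds, eval]

end Expr

theorem Cmd.eval_ite_pos {n : ℕ} {e : Expr} {c c' : Cmd} {σ : State} (h : e.Holds n σ) :
    (Cmd.ite e c c').eval n σ = c.eval n σ := if_pos h

theorem Cmd.eval_ite_neg {n : ℕ} {e : Expr} {c c' : Cmd} {σ : State} (h : ¬ e.Holds n σ) :
    (Cmd.ite e c c').eval n σ = c'.eval n σ := if_neg h

/-- `σ` agrees with `σ₀` on the variables below `8` and on the memory cells below `B`. -/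
structure Frame (B : ℕ) (σ₀ σ : State) : Prop where
  reg : ∀ r < 8, σ.reg r = σ₀.reg r
  mem : ∀ i < B, σ.mem i = σ₀.mem i

theorem Frame.refl (B : ℕ) (σ : State) : Frame B σ σ := ⟨fun _ _ => rfl, fun _ _ => rfl⟩

theorem Frame.trans {B B' : ℕ} {σ σ' σ'' : State} (h : Frame B σ σ') (h' : Frame B' σ' σ'')
    (hB : B ≤ B') : Frame B σ σ'' :=
  ⟨fun r hr => (h'.reg r hr).trans (h.reg r hr),
    fun i hi => (h'.mem i (by omega)).trans (h.mem i hi)⟩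

theorem Frame.setReg {B : ℕ} {σ₀ σ : State} (h : Frame B σ₀ σ) {r : ℕ} (hr : 8 ≤ r) (v : ℕ) :
    Frame B σ₀ (σ.setReg r v) :=
  ⟨fun r' hr' => by rw [State.setReg_reg, if_neg (by omega), h.reg r' hr'], h.mem⟩

theorem Frame.setMem {B : ℕ} {σ₀ σ : State} (h : Frame B σ₀ σ) {a : ℕ} (ha : B ≤ a) (v : ℕ) :
    Frame B σ₀ (σ.setMem a v) :=
  ⟨h.reg, fun i hi => by rw [State.setMem_mem, if_neg (by omega), h.mem i hi]⟩

end RAM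

/-! ### Memory layout and subroutines -/

namespace ConflictFreeCut

open RAM

/-! Variables: `0` the length of the input, `1` the budget `k`, `2` the power `2 ^ k`, `3` the bits
of the current pass, `4` a flag that is on until a vertex cover is found, `5` the answer, `6` and `7`
the vertices that must get different colours, `8` the bits not read yet, `9` a counter.
Memory: the input, the vertex cover, the colouring, the matrix of implications. -/

/-- The offset `n + 1` skips the unary size and its separator. -/
def adjE (a b : Expr) : Expr := .load (.add (.add .size (.lit 1)) (.add (.scale a) b))

/-- The index is the base-`n` numeral with digits `u`, `v`, `x`, `y`; Horner's scheme needs only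
multiplications by `n`. -/
def conflictE (u v x y : Expr) : Expr :=
  .load (.add (.add (.add .size (.lit 1)) (.scale .size))
    (.add (.scale (.add (.scale (.add (.scale u) v)) x)) y))

/-- The work area begins right after the input word: cover, colouring and matrix start at the
offsets `0`, `2 * n` and `4 * n`. -/
def coverAddr (v : Expr) : Expr := .add (.var 0) v

def colourAddr (v : Expr) : Expr := .add (.add (.var 0) (.add .size .size)) v

def matrixAddr (l m : Expr) : Expr :=
  .add (.add (.var 0) (.add (.add .size .size) (.add .size .size))) (.add (.scale (.add l l)) m)

/-- The vertices whose cells from `B` on are nonzero are those in `S`. -/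
def Stores (n B : ℕ) (S : Set ℕ) (σ : State) : Prop := ∀ v < n, σ.mem (B + v) ≠ 0 ↔ v ∈ S

theorem Stores.frame {n B B' : ℕ} {S : Set ℕ} {σ σ' : State} (h : Stores n B S σ)
    (h' : Frame B' σ σ') (hB : B + n ≤ B') : Stores n B S σ' := fun v hv => by
  rw [h'.mem _ (by omega), h v hv]

/-- Clear `n` memory cells. -/
def clearCmd (addr : Expr → Expr) : Cmd := .loop false 10 (.store (addr (.var 10)) (.lit 0))

theorem clearCmd_spec {n B : ℕ} {addr : Expr → Expr} {σ : State}
    (haddr : ∀ τ : State, τ.reg 0 = σ.reg 0 → (addr (.var 10)).eval n τ = B + τ.reg 10) :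
    Frame B σ ((clearCmd addr).eval n σ) ∧ Stores n B ∅ ((clearCmd addr).eval n σ) := by
  simp only [clearCmd, Cmd.eval, bound_false]
  refine iter_induction (n := n)
    (fun i τ => Frame B σ τ ∧ Stores i B ∅ τ) (fun i τ hi h => ?_)
    ⟨.refl _ _, fun v hv => absurd hv (by omega)⟩
  rw [haddr _ (by simpa using h.1.reg 0 (by omega))]
  refine ⟨(h.1.setReg (by omega) _).setMem (by omega) _, fun v hv => ?_⟩
  simp only [State.setReg_reg, if_true, State.setMem_mem, State.setReg_mem, Expr.eval]
  by_cases hvi : v = i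
  · simp [hvi]
  · rw [if_neg (by omega)]
    exact h.2 v (by omega)

/-- The input data in the memory. -/
structure HasInput (n : ℕ) (A : ℕ → ℕ → Prop) (C : ℕ → ℕ → ℕ → ℕ → Prop) (σ : State) : Prop where
  adj_lt : ∀ a < n, ∀ b < n, n + 1 + (n * a + b) < σ.reg 0
  adj : ∀ a < n, ∀ b < n, σ.mem (n + 1 + (n * a + b)) ≠ 0 ↔ A a b
  conflict_lt : ∀ u < n, ∀ v < n, ∀ x < n, ∀ y < n,
    n + 1 + n * n + (n * (n * (n * u + v) + x) + y) < σ.reg 0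
  conflict : ∀ u < n, ∀ v < n, ∀ x < n, ∀ y < n,
    σ.mem (n + 1 + n * n + (n * (n * (n * u + v) + x) + y)) ≠ 0 ↔ C u v x y

theorem HasInput.frame {n B : ℕ} {A : ℕ → ℕ → Prop} {C : ℕ → ℕ → ℕ → ℕ → Prop} {σ σ' : State}
    (h : HasInput n A C σ) (h' : Frame B σ σ') (hB : σ.reg 0 ≤ B) : HasInput n A C σ' where
  adj_lt a ha b hb := by rw [h'.reg 0 (by omega)]; exact h.adj_lt a ha b hb
  adj a ha b hb := by
    rw [h'.mem _ ((h.adj_lt a ha b hb).trans_le hB)]; exact h.adj a ha b hb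
  conflict_lt u hu v hv x hx y hy := by
    rw [h'.reg 0 (by omega)]; exact h.conflict_lt u hu v hv x hx y hy
  conflict u hu v hv x hx y hy := by
    rw [h'.mem _ ((h.conflict_lt u hu v hv x hx y hy).trans_le hB)]
    exact h.conflict u hu v hv x hx y hy

def coverBody : Cmd :=
  .ite (.and (adjE (.var 10) (.var 11)) (.and (.not (.load (coverAddr (.var 10))))
      (.not (.load (coverAddr (.var 11))))))
    (.seq (.assign 8 (.add (.var 8) (.var 8))) (.seq (.assign 9 (.add (.var 9) (.lit 1)))
      (.ite (.lt (.var 8) (.var 2)) (.store (coverAddr (.var 11)) (.lit 1))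
        (.seq (.assign 8 (.sub (.var 8) (.var 2))) (.store (coverAddr (.var 10)) (.lit 1))))))
    .skip

/-- The greedy construction of a vertex cover. -/
def coverCmd : Cmd :=
  .seq (clearCmd coverAddr) (.seq (.assign 9 (.lit 0)) (.seq (.assign 8 (.var 3))
    (.loop false 10 (.loop false 11 coverBody))))

/-- The state `σ` represents a state of the greedy construction. -/
structure CoverState (n : ℕ) (σ₀ σ : State) (st : Finset ℕ × ℕ × ℕ) : Prop where
  frame : Frame (σ₀.reg 0) σ₀ σ
  stores : Stores n (σ₀.reg 0) st.1 σ
  counter : σ.reg 9 = st.2.1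
  bits : σ.reg 8 = st.2.2

theorem CoverState.setReg {n : ℕ} {σ₀ σ : State} {st : Finset ℕ × ℕ × ℕ}
    (h : CoverState n σ₀ σ st) {r : ℕ} (hr : 10 ≤ r) (v : ℕ) :
    CoverState n σ₀ (σ.setReg r v) st where
  frame := h.frame.setReg (by omega) v
  stores := h.stores
  counter := by rw [State.setReg_reg, if_neg (by omega), h.counter]
  bits := by rw [State.setReg_reg, if_neg (by omega), h.bits]

theorem Stores.insert {n B w v : ℕ} {S : Set ℕ} {σ : State} (h : Stores n B S σ) (hv : v ≠ 0) :
    Stores n B (insert w S) (σ.setMem (B + w) v) := fun x hx => by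
  rw [State.setMem_mem]
  by_cases hxw : x = w
  · simp [hxw, hv]
  · rw [if_neg (by omega), h x hx]; simp [hxw]

theorem Stores.erase {n B w : ℕ} {S : Set ℕ} {σ : State} (h : Stores n B S σ) :
    Stores n B (S \ {w}) (σ.setMem (B + w) 0) := fun x hx => by
  rw [State.setMem_mem]
  by_cases hxw : x = w
  · simp [hxw]
  · rw [if_neg (by omega), h x hx]; simp [hxw]

theorem coverBody_spec {n : ℕ} {A : ℕ → ℕ → Prop} {C : ℕ → ℕ → ℕ → ℕ → Prop} {σ₀ σ : State}
    (hin : HasInput n A C σ₀) {st : Finset ℕ × ℕ × ℕ} (h : CoverState n σ₀ σ st) {a b : ℕ}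
    (ha : a < n) (hb : b < n) (h10 : σ.reg 10 = a) (h11 : σ.reg 11 = b) :
    CoverState n σ₀ (coverBody.eval n σ) (coverStep A (σ₀.reg 2) a b st) ∧
      (coverBody.eval n σ).reg 10 = a := by
  classical
  have h0 := h.frame.reg 0 (by omega)
  have h2 := h.frame.reg 2 (by omega)
  have hin' := hin.frame h.frame le_rfl
  have hc : (Expr.and (adjE (.var 10) (.var 11)) (.and (.not (.load (coverAddr (.var 10))))
      (.not (.load (coverAddr (.var 11)))))).Holds n σ ↔ A a b ∧ a ∉ st.1 ∧ b ∉ st.1 := by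
    have e1 := hin'.adj a ha b hb
    have e2 := h.stores a ha
    have e3 := h.stores b hb
    rw [Expr.holds_and, Expr.holds_and, Expr.holds_not, Expr.holds_not, adjE, Expr.holds_load,
      Expr.holds_load, Expr.holds_load]
    simp only [Expr.eval, coverAddr, h10, h11, h0]
    rw [e1, e2, e3, Finset.mem_coe, Finset.mem_coe]
  by_cases hcond : A a b ∧ a ∉ st.1 ∧ b ∉ st.1
  · rw [coverBody, Cmd.eval_ite_pos (hc.2 hcond), coverStep, if_pos hcond]
    simp only [Cmd.eval, Expr.eval, Expr.lt, coverAddr]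
    simp only [State.setReg_reg, h.bits, h.counter, h2, h0, h10, h11, Nat.reduceEqDiff,
      if_true, if_false]
    split_ifs with h3 h4 h4
    · refine ⟨⟨((h.frame.setReg (by omega) _).setReg (by omega) _).setMem (by omega) _, ?_, ?_,
        ?_⟩, ?_⟩
      · rw [Finset.coe_insert]
        exact Stores.insert (σ := (σ.setReg 8 _).setReg 9 _) h.stores (by omega)
      all_goals simp [h10]
    · omega
    · omega
    · refine ⟨⟨(((h.frame.setReg (by omega) _).setReg (by omega) _).setReg (by omega) _).setMem
        (by omega) _, ?_, ?_, ?_⟩, ?_⟩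
      · rw [Finset.coe_insert]
        exact Stores.insert (σ := ((σ.setReg 8 _).setReg 9 _).setReg 8 _) h.stores (by omega)
      all_goals simp [h10]
  · rw [coverBody, Cmd.eval_ite_neg (mt hc.1 hcond), coverStep, if_neg hcond]
    exact ⟨h, h10⟩

/-- No assumption on the cells of the cover is needed, because they are cleared first; earlier
passes have left their sets there. -/
theorem coverCmd_spec {n : ℕ} {A : ℕ → ℕ → Prop} {C : ℕ → ℕ → ℕ → ℕ → Prop} {σ : State}
    (hin : HasInput n A C σ) :
    CoverState n σ (coverCmd.eval n σ) (cover n A (σ.reg 2) (σ.reg 3)) := by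
  obtain ⟨f, hs⟩ := clearCmd_spec (n := n) (B := σ.reg 0) (addr := coverAddr) (σ := σ)
    (fun τ hτ => by simp [coverAddr, Expr.eval, hτ])
  simp only [coverCmd, Cmd.eval, Expr.eval, bound_false]
  refine iter_simulation (n := n) (CoverState n σ) (fun i τ st hi h => ?_)
    ⟨(f.setReg (by omega) _).setReg (by omega) _, fun v hv => ?_, ?_, ?_⟩
  · refine (iter_simulation (n := n) (fun τ st => CoverState n σ τ st ∧ τ.reg 10 = i)
      (fun j τ st hj h => ?_) ⟨h.setReg le_rfl i, by simp⟩).1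
    exact coverBody_spec hin (h.1.setReg (by omega) _) hi hj (by simp [h.2]) (by simp)
  · simpa using hs v hv
  · simp
  · simpa using f.reg 3 (by omega)

def colourBody : Cmd :=
  .ite (.load (coverAddr (.var 10)))
    (.seq (.assign 8 (.add (.var 8) (.var 8)))
      (.ite (.lt (.var 8) (.var 2)) (.store (colourAddr (.var 10)) (.lit 0))
        (.seq (.assign 8 (.sub (.var 8) (.var 2))) (.store (colourAddr (.var 10)) (.lit 1)))))
    .skip

/-- Colour the vertex cover as the bits say. -/
def colourCmd : Cmd :=
  .seq (clearCmd colourAddr) (.seq (.assign 8 (.var 3)) (.loop false 10 colourBody))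

/-- The state `σ` represents a partial colouring. -/
structure ColourState (n : ℕ) (σ₀ σ : State) (st : Set ℕ × ℕ) : Prop where
  frame : Frame (σ₀.reg 0 + (n + n)) σ₀ σ
  stores : Stores n (σ₀.reg 0 + (n + n)) st.1 σ
  bits : σ.reg 8 = st.2

theorem colourBody_spec {n : ℕ} {X : Finset ℕ} {σ₀ σ : State} (hX : Stores n (σ₀.reg 0) X σ₀)
    {st : Set ℕ × ℕ} (h : ColourState n σ₀ σ st) {v : ℕ} (hv : v < n) (h10 : σ.reg 10 = v) :
    ColourState n σ₀ (colourBody.eval n σ) (colourStep X (σ₀.reg 2) v st) := by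
  have h0 := h.frame.reg 0 (by omega)
  have h2 := h.frame.reg 2 (by omega)
  have hc : (Expr.load (coverAddr (.var 10))).Holds n σ ↔ v ∈ X := by
    rw [Expr.holds_load]
    simp only [Expr.eval, coverAddr, h10, h0]
    exact hX.frame h.frame (by omega) v hv
  by_cases hcond : v ∈ X
  · rw [colourBody, Cmd.eval_ite_pos (hc.2 hcond), colourStep, if_pos hcond]
    simp only [Cmd.eval, Expr.eval, Expr.lt, colourAddr]
    simp only [State.setReg_reg, h.bits, h2, h0, h10, Nat.reduceEqDiff, if_true, if_false]
    split_ifs with h3 h4 h4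
    · exact ⟨(h.frame.setReg (by omega) _).setMem (by omega) _,
        Stores.erase (σ := σ.setReg 8 _) h.stores, by simp⟩
    · omega
    · omega
    · exact ⟨((h.frame.setReg (by omega) _).setReg (by omega) _).setMem (by omega) _,
        Stores.insert (σ := (σ.setReg 8 _).setReg 8 _) h.stores (by omega), by simp⟩
  · rw [colourBody, Cmd.eval_ite_neg (mt hc.1 hcond), colourStep, if_neg hcond]
    exact h

theorem colourCmd_spec {n : ℕ} {X : Finset ℕ} {σ : State} (hX : Stores n (σ.reg 0) X σ) :
    ColourState n σ (colourCmd.eval n σ) (iter (colourStep X (σ.reg 2)) n (∅, σ.reg 3)) := by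
  obtain ⟨f, hs⟩ := clearCmd_spec (n := n) (B := σ.reg 0 + (n + n)) (addr := colourAddr) (σ := σ)
    (fun τ hτ => by simp [colourAddr, Expr.eval, hτ])
  simp only [colourCmd, Cmd.eval, Expr.eval, bound_false]
  refine iter_simulation (n := n) (ColourState n σ) (fun i τ st hi h => ?_)
    ⟨f.setReg (by omega) _, fun v hv => ?_, ?_⟩
  · exact colourBody_spec hX (σ := τ.setReg 10 i) ⟨h.frame.setReg (by omega) _, h.stores,
      by simpa using h.bits⟩ hi (by simp)
  · simpa using hs v hv
  · simpa using f.reg 3 (by omega)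

/-! ### The matrix of implications -/

def negE (l : Expr) : Expr :=
  .ite (.lt l .size) (.add l .size) (.ite (.lt l (.add .size .size)) (.sub l .size) l)

def varE (l : Expr) : Expr := .ite (.lt l .size) l (.sub l .size)

theorem eval_negE {n : ℕ} {l : Expr} {σ : State} :
    (negE l).eval n σ = litNeg n (l.eval n σ) := by
  simp only [negE, litNeg, Expr.eval, Expr.lt, ne_eq, Nat.sub_eq_zero_iff_le, not_le]

theorem eval_varE {n : ℕ} {l : Expr} {σ : State} :
    (varE l).eval n σ = litVar n (l.eval n σ) := by
  simp only [varE, litVar, Expr.eval, Expr.lt, ne_eq, Nat.sub_eq_zero_iff_le, not_le]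

/-- The implication from literal `10` to literal `11`. -/
def impliesE : Expr :=
  .or (.and (.eq (.var 11) (negE (.var 10)))
      (.or (.and (.load (coverAddr (varE (.var 11))))
          (.iff (.lt (.var 11) .size) (.load (colourAddr (varE (.var 11))))))
        (.or (.eq (.var 11) (.var 6)) (.eq (.var 11) (.add (.var 7) .size)))))
    (.sum false 12 (.sum false 13 (.and (.load (coverAddr (.var 12)))
      (.and (.load (coverAddr (.var 13)))
      (.and (conflictE (.var 12) (varE (.var 10)) (.var 13) (varE (.var 11)))
      (.and (.iff (.lt (.var 10) .size) (.not (.load (colourAddr (.var 12)))))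
        (.iff (.lt (.var 11) .size) (.load (colourAddr (.var 13))))))))))

/-- The sums range over `u, x < n` only; nothing is lost because members of `X` are below `n`. -/
theorem holds_impliesE {n : ℕ} {A : ℕ → ℕ → Prop} {C : ℕ → ℕ → ℕ → ℕ → Prop} {σ : State}
    (hin : HasInput n A C σ) {X : Finset ℕ} (hXn : ∀ v ∈ X, v < n) {S : Set ℕ}
    (hX : Stores n (σ.reg 0) X σ) (hS : Stores n (σ.reg 0 + (n + n)) S σ)
    (h10 : σ.reg 10 < n + n) (h11 : σ.reg 11 < n + n) :
    impliesE.Holds n σ ↔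
      Implies n C (· ∈ X) (· ∈ S) (σ.reg 6) (σ.reg 7) (σ.reg 10) (σ.reg 11) := by
  have hv : ∀ l < n + n, litVar n l < n := fun l hl => by unfold litVar; split_ifs <;> omega
  have e1 := hX _ (hv _ h11)
  have e2 := hS _ (hv _ h11)
  rw [Finset.mem_coe] at e1
  simp only [impliesE, Expr.holds_or, Expr.holds_and, Expr.holds_not, Expr.holds_iff, Expr.holds_lt,
    Expr.holds_eq, Expr.holds_sum, Expr.holds_load, conflictE, coverAddr, colourAddr, eval_negE,
    eval_varE, Expr.eval, State.setReg_reg, State.setReg_mem, Nat.reduceEqDiff, if_true, if_false,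
    bound_false]
  rw [e1, e2, Implies, and_iff_right h10, and_iff_right h11]
  refine or_congr Iff.rfl ⟨?_, ?_⟩
  · rintro ⟨u, hu, x, hx, hXu, hXx, hC, hSu, hSx⟩
    rw [hX u hu] at hXu
    rw [hX x hx] at hXx
    rw [hS u hu] at hSu
    rw [hS x hx] at hSx
    rw [hin.conflict _ hu _ (hv _ h10) _ hx _ (hv _ h11)] at hC
    exact ⟨u, x, hXu, hXx, hC, hSu, hSx⟩
  · rintro ⟨u, x, hXu, hXx, hC, hSu, hSx⟩
    have hu := hXn u hXu
    have hx := hXn x hXx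
    refine ⟨u, hu, x, hx, ?_, ?_, ?_, ?_, ?_⟩
    · rw [hX u hu]; exact hXu
    · rw [hX x hx]; exact hXx
    · rw [hin.conflict _ hu _ (hv _ h10) _ hx _ (hv _ h11)]; exact hC
    · rw [hS u hu]; exact hSu
    · rw [hS x hx]; exact hSx

/-- Rows have length `2 * n`, so row and column are quotient and remainder. Hence a write to one
entry disturbs no other. -/
theorem matrix_index_injective {n l m l' m' : ℕ} (hm : m < n + n) (hm' : m' < n + n)
    (h : n * (l + l) + m = n * (l' + l') + m') : l = l' ∧ m = m' := by
  have e : ∀ i, n * (i + i) = i * (n + n) := fun i => by ring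
  rw [e, e] at h
  have h1 : l = l' := by
    rcases lt_trichotomy l l' with hlt | heq | hlt
    · have := Nat.mul_le_mul_right (n + n) hlt
      rw [Nat.succ_mul] at this
      omega
    · exact heq
    · have := Nat.mul_le_mul_right (n + n) hlt
      rw [Nat.succ_mul] at this
      omega
  subst h1
  exact ⟨rfl, by omega⟩

/-- Fill the matrix of implications. -/
def fillCmd : Cmd :=
  .loop true 10 (.loop true 11 (.store (matrixAddr (.var 10) (.var 11)) impliesE))

/-- The matrix from cell `B` on represents the relation `P`. -/
def StoresMatrix (n B : ℕ) (P : ℕ → ℕ → Prop) (σ : State) : Prop :=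
  ∀ l < n + n, ∀ m < n + n, σ.mem (B + (n * (l + l) + m)) ≠ 0 ↔ P l m

/-- The condition is evaluated while the matrix is being written, but the memory it reads (input,
cover, colouring) lies below `B` and is protected by the frame. -/
theorem fillCmd_spec {n : ℕ} {A : ℕ → ℕ → Prop} {C : ℕ → ℕ → ℕ → ℕ → Prop} {σ : State}
    (hin : HasInput n A C σ) {X : Finset ℕ} (hXn : ∀ v ∈ X, v < n) {S : Set ℕ}
    (hX : Stores n (σ.reg 0) X σ) (hS : Stores n (σ.reg 0 + (n + n)) S σ) :
    Frame (σ.reg 0 + (n + n + (n + n))) σ (fillCmd.eval n σ) ∧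
      StoresMatrix n (σ.reg 0 + (n + n + (n + n)))
        (Implies n C (· ∈ X) (· ∈ S) (σ.reg 6) (σ.reg 7)) (fillCmd.eval n σ) := by
  set B := σ.reg 0 + (n + n + (n + n)) with hB
  set E := Implies n C (· ∈ X) (· ∈ S) (σ.reg 6) (σ.reg 7)
  simp only [fillCmd, Cmd.eval, bound_true]
  have := iter_induction (n := n + n) (f := fun i τ => iter (fun i τ =>
      (τ.setReg 11 i).setMem ((matrixAddr (.var 10) (.var 11)).eval n (τ.setReg 11 i))
        (impliesE.eval n (τ.setReg 11 i))) (n + n) (τ.setReg 10 i))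
    (fun i τ => Frame B σ τ ∧ ∀ l < i, ∀ m < n + n,
      τ.mem (B + (n * (l + l) + m)) ≠ 0 ↔ E l m) (a := σ) ?_
    ⟨.refl _ _, fun l hl => absurd hl (by omega)⟩
  · exact this
  intro i τ hi hτ
  have := iter_induction (n := n + n) (f := fun i τ =>
      (τ.setReg 11 i).setMem ((matrixAddr (.var 10) (.var 11)).eval n (τ.setReg 11 i))
        (impliesE.eval n (τ.setReg 11 i)))
    (fun j τ => (Frame B σ τ ∧ τ.reg 10 = i) ∧ ∀ l m, m < n + n → (l < i ∨ l = i ∧ m < j) →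
      (τ.mem (B + (n * (l + l) + m)) ≠ 0 ↔ E l m)) (a := τ.setReg 10 i) ?_
    ⟨⟨hτ.1.setReg (by omega) _, by simp⟩, fun l m hm hl =>
      hτ.2 l (hl.resolve_right (by omega)) m hm⟩
  · exact ⟨this.1.1, fun l hl m hm => this.2 l m hm (by omega)⟩
  rintro j τ hj ⟨⟨f, h10⟩, h⟩
  have f' := f.setReg (r := 11) (by omega) j
  have e : (matrixAddr (.var 10) (.var 11)).eval n (τ.setReg 11 j) = B + (n * (i + i) + j) := by
    simp [matrixAddr, Expr.eval, h10, f.reg 0 (by omega), hB]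
  rw [e]
  refine ⟨⟨f'.setMem (by omega) _, by simp [h10]⟩, fun l m hm hl => ?_⟩
  rw [State.setMem_mem]
  by_cases hlm : l = i ∧ m = j
  · obtain ⟨rfl, rfl⟩ := hlm
    rw [if_pos rfl]
    have h0 := f'.reg 0 (by omega)
    have := holds_impliesE (hin.frame f' (by omega)) hXn (by
      rw [h0]; exact hX.frame f' (by omega)) (by rw [h0]; exact hS.frame f' (by omega))
      (by simpa [h10] using hi) (by simpa using hj)
    rw [f'.reg 6 (by omega), f'.reg 7 (by omega)] at this
    simp only [State.setReg_reg, if_true, Nat.reduceEqDiff, if_false, h10] at this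
    exact this
  · rw [if_neg]
    · exact h l m hm (by omega)
    · intro h'
      exact hlm (matrix_index_injective hm hj (by omega))

/-- Close the matrix under composition. -/
def closeCmd : Cmd :=
  .loop true 12 (.loop true 10 (.loop true 11
    (.ite (.and (.load (matrixAddr (.var 10) (.var 12))) (.load (matrixAddr (.var 12) (.var 11))))
      (.store (matrixAddr (.var 10) (.var 11)) (.lit 1)) .skip)))

/-- The closure is computed in place, so a pass may read cells that it has already updated. It
suffices that every cell lies between stage `k` and stage `k + 1` of `warshall`: on row `k` and
column `k`, the only cells read, these stages coincide. -/
theorem closeCmd_spec {n : ℕ} {σ : State} {E : ℕ → ℕ → Prop}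
    (hE : StoresMatrix n (σ.reg 0 + (n + n + (n + n))) E σ) :
    Frame (σ.reg 0 + (n + n + (n + n))) σ (closeCmd.eval n σ) ∧
      StoresMatrix n (σ.reg 0 + (n + n + (n + n))) (warshall E (n + n)) (closeCmd.eval n σ) := by
  set B := σ.reg 0 + (n + n + (n + n)) with hB
  rw [closeCmd, Cmd.eval, bound_true]
  refine iter_induction (n := n + n) (fun k τ => Frame B σ τ ∧ StoresMatrix n B (warshall E k) τ)
    ?_ ⟨.refl _ _, hE⟩
  rintro k τ hk ⟨f, hτ⟩
  rw [Cmd.eval, bound_true]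
  have := iter_induction (n := n + n) (f := fun i τ => (Cmd.loop true 11
      (.ite (.and (.load (matrixAddr (.var 10) (.var 12)))
        (.load (matrixAddr (.var 12) (.var 11))))
        (.store (matrixAddr (.var 10) (.var 11)) (.lit 1)) .skip)).eval n (τ.setReg 10 i))
    (fun i τ => (Frame B σ τ ∧ τ.reg 12 = k) ∧ ∀ l < n + n, ∀ m < n + n,
      (τ.mem (B + (n * (l + l) + m)) ≠ 0 → warshall E (k + 1) l m) ∧
      (warshall E k l m → τ.mem (B + (n * (l + l) + m)) ≠ 0) ∧
      (l < i → warshall E (k + 1) l m → τ.mem (B + (n * (l + l) + m)) ≠ 0))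
    (a := τ.setReg 12 k) ?_ ⟨⟨f.setReg (by omega) _, by simp⟩, fun l hl m hm =>
      ⟨fun h => .inl ((hτ l hl m hm).1 h), (hτ l hl m hm).2, fun h => absurd h (by omega)⟩⟩
  · exact ⟨this.1.1, fun l hl m hm => ⟨(this.2 l hl m hm).1, (this.2 l hl m hm).2.2 hl⟩⟩
  clear hτ f
  rintro i τ hi ⟨⟨f, h12⟩, hτ⟩
  rw [Cmd.eval, bound_true]
  have := iter_induction (n := n + n) (f := fun i τ => (Cmd.ite
      (.and (.load (matrixAddr (.var 10) (.var 12))) (.load (matrixAddr (.var 12) (.var 11))))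
      (.store (matrixAddr (.var 10) (.var 11)) (.lit 1)) .skip).eval n (τ.setReg 11 i))
    (fun j τ => (Frame B σ τ ∧ τ.reg 12 = k ∧ τ.reg 10 = i) ∧ ∀ l < n + n, ∀ m < n + n,
      (τ.mem (B + (n * (l + l) + m)) ≠ 0 → warshall E (k + 1) l m) ∧
      (warshall E k l m → τ.mem (B + (n * (l + l) + m)) ≠ 0) ∧
      (l < i ∨ l = i ∧ m < j → warshall E (k + 1) l m → τ.mem (B + (n * (l + l) + m)) ≠ 0))
    (a := τ.setReg 10 i) ?_ ⟨⟨f.setReg (by omega) _, by simp [h12], by simp⟩, fun l hl m hm =>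
      ⟨(hτ l hl m hm).1, (hτ l hl m hm).2.1,
        fun h => (hτ l hl m hm).2.2 (h.resolve_right (by omega))⟩⟩
  · exact ⟨⟨this.1.1, this.1.2.1⟩, fun l hl m hm => ⟨(this.2 l hl m hm).1, (this.2 l hl m hm).2.1,
      fun h => (this.2 l hl m hm).2.2 (by omega)⟩⟩
  clear hτ f h12
  rintro j τ hj ⟨⟨f, h12, h10⟩, hτ⟩
  have h0 := f.reg 0 (by omega)
  have f' := f.setReg (r := 11) (by omega) j
  have hc : (Expr.and (.load (matrixAddr (.var 10) (.var 12)))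
      (.load (matrixAddr (.var 12) (.var 11)))).Holds n (τ.setReg 11 j) ↔
      warshall E k i k ∧ warshall E k k j := by
    rw [Expr.holds_and, Expr.holds_load, Expr.holds_load]
    simp only [matrixAddr, Expr.eval, State.setReg_reg, State.setReg_mem, Nat.reduceEqDiff,
      if_true, if_false, h10, h12, h0, ← hB]
    refine and_congr ⟨fun h => ?_, (hτ i hi k hk).2.1⟩ ⟨fun h => ?_, (hτ k hk j hj).2.1⟩
    · exact ((hτ i hi k hk).1 h).elim id (·.1)
    · exact ((hτ k hk j hj).1 h).elim id (·.2)
  by_cases hcond : warshall E k i k ∧ warshall E k k j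
  · rw [Cmd.eval_ite_pos (hc.2 hcond)]
    have e : (matrixAddr (.var 10) (.var 11)).eval n (τ.setReg 11 j) = B + (n * (i + i) + j) := by
      simp [matrixAddr, Expr.eval, h10, h0, hB]
    rw [Cmd.eval, e, Expr.eval]
    refine ⟨⟨f'.setMem (by omega) _, by simp [h12], by simp [h10]⟩, fun l hl m hm => ?_⟩
    rw [State.setMem_mem]
    by_cases hlm : l = i ∧ m = j
    · obtain ⟨rfl, rfl⟩ := hlm
      rw [if_pos rfl]
      exact ⟨fun _ => .inr hcond, fun _ => one_ne_zero, fun _ _ => one_ne_zero⟩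
    · rw [if_neg fun h' => hlm (matrix_index_injective hm hj (by omega))]
      exact ⟨(hτ l hl m hm).1, (hτ l hl m hm).2.1, fun h => (hτ l hl m hm).2.2 (by omega)⟩
  · rw [Cmd.eval_ite_neg (mt hc.1 hcond), Cmd.eval]
    refine ⟨⟨f', by simp [h12], by simp [h10]⟩, fun l hl m hm =>
      ⟨(hτ l hl m hm).1, (hτ l hl m hm).2.1, fun h h' => ?_⟩⟩
    by_cases hlm : l = i ∧ m = j
    · obtain ⟨rfl, rfl⟩ := hlm
      exact (hτ l hl m hm).2.1 (h'.resolve_right hcond)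
    · exact (hτ l hl m hm).2.2 (by omega) h'

/-- Some literal and its negation imply each other. -/
def clashE : Expr :=
  .sum true 10 (.and (.load (matrixAddr (.var 10) (negE (.var 10))))
    (.load (matrixAddr (negE (.var 10)) (.var 10))))

/-- Try to extend the colouring of the vertex cover so that vertex `6` is coloured and vertex `7` is
not. -/
def extendCmd : Cmd :=
  .seq fillCmd (.seq closeCmd (.ite clashE .skip (.assign 5 (.lit 1))))

/-- `σ` agrees with `σ₀` on the variables below `5` and on the memory cells below `B`; the answer
is switched on if `p` holds. -/
structure Answers (B : ℕ) (p : Prop) (σ₀ σ : State) : Prop where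
  reg : ∀ r < 5, σ.reg r = σ₀.reg r
  mem : ∀ i < B, σ.mem i = σ₀.mem i
  pos : p → σ.reg 5 = 1
  neg : ¬ p → σ.reg 5 = σ₀.reg 5

/-- Variable `6` is recorded separately: it is the index of the outer loop over pairs and must
survive the inner one, whereas `Answers` protects only the variables below `5`. -/
theorem extendCmd_spec {n : ℕ} {A : ℕ → ℕ → Prop} {C : ℕ → ℕ → ℕ → ℕ → Prop} {σ : State}
    (hin : HasInput n A C σ) {X : Finset ℕ} (hXn : ∀ v ∈ X, v < n) {S : Set ℕ}
    (hX : Stores n (σ.reg 0) X σ) (hS : Stores n (σ.reg 0 + (n + n)) S σ) :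
    Answers (σ.reg 0 + (n + n + (n + n)))
      (Consistent n C (· ∈ X) (· ∈ S) (σ.reg 6) (σ.reg 7)) σ (extendCmd.eval n σ) ∧
      (extendCmd.eval n σ).reg 6 = σ.reg 6 := by
  obtain ⟨f₁, h₁⟩ := fillCmd_spec hin hXn hX hS
  have h0 := f₁.reg 0 (by omega)
  rw [← h0] at h₁
  obtain ⟨f₂, h₂⟩ := closeCmd_spec h₁
  rw [h0] at f₂ h₂
  have f := f₁.trans f₂ le_rfl
  have hc : clashE.Holds n (closeCmd.eval n (fillCmd.eval n σ)) ↔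
      ¬ Consistent n C (· ∈ X) (· ∈ S) (σ.reg 6) (σ.reg 7) := by
    rw [clashE, Expr.holds_sum, Consistent]
    push Not
    simp only [bound_true]
    refine exists_congr fun l => and_congr_right fun hl => ?_
    have hl' : litNeg n l < n + n := by unfold litNeg; split_ifs <;> omega
    rw [Expr.holds_and, Expr.holds_load, Expr.holds_load, ← h₂ _ hl _ hl', ← h₂ _ hl' _ hl]
    simp only [matrixAddr, Expr.eval, State.setReg_reg, State.setReg_mem, Nat.reduceEqDiff,
      if_true, if_false, eval_negE, f.reg 0 (by omega : 0 < 8)]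
  rw [extendCmd, Cmd.eval, Cmd.eval]
  by_cases h : Consistent n C (· ∈ X) (· ∈ S) (σ.reg 6) (σ.reg 7)
  · rw [Cmd.eval_ite_neg (by rw [hc]; exact not_not.2 h), Cmd.eval, Expr.eval]
    refine ⟨⟨fun r hr => ?_, f.mem, fun _ => by simp, fun h' => absurd h h'⟩, ?_⟩
    · rw [State.setReg_reg, if_neg (by omega), f.reg r (by omega)]
    · rw [State.setReg_reg, if_neg (by omega), f.reg 6 (by omega)]
  · rw [Cmd.eval_ite_pos (hc.2 h), Cmd.eval]
    exact ⟨⟨fun r hr => f.reg r (by omega), f.mem, fun h' => absurd h' h,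
      fun _ => f.reg 5 (by omega)⟩, f.reg 6 (by omega)⟩

/-- Try all pairs of vertices. -/
def pairsCmd : Cmd := .loop false 6 (.loop false 7 extendCmd)

theorem Answers.refl (B : ℕ) {p : Prop} (hp : ¬ p) (σ : State) : Answers B p σ σ :=
  ⟨fun _ _ => rfl, fun _ _ => rfl, fun h => absurd h hp, fun _ => rfl⟩

theorem Answers.setReg {B : ℕ} {p : Prop} {σ₀ σ : State} (h : Answers B p σ₀ σ) {r : ℕ}
    (hr : 5 < r) (v : ℕ) : Answers B p σ₀ (σ.setReg r v) where
  reg r' hr' := by rw [State.setReg_reg, if_neg (by omega), h.reg r' hr']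
  mem := h.mem
  pos hp := by rw [State.setReg_reg, if_neg (by omega), h.pos hp]
  neg hp := by rw [State.setReg_reg, if_neg (by omega), h.neg hp]

theorem Answers.trans {B : ℕ} {p q : Prop} {σ σ' σ'' : State} (h : Answers B p σ σ')
    (h' : Answers B q σ' σ'') : Answers B (p ∨ q) σ σ'' where
  reg r hr := (h'.reg r hr).trans (h.reg r hr)
  mem i hi := (h'.mem i hi).trans (h.mem i hi)
  pos hpq := by
    by_cases hq : q
    · exact h'.pos hq
    · rw [h'.neg hq, h.pos (hpq.resolve_right hq)]
  neg hpq := by rw [h'.neg fun hq => hpq (.inr hq), h.neg fun hp => hpq (.inl hp)]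

theorem Answers.congr {B B' : ℕ} {p q : Prop} {σ σ' : State} (h : Answers B p σ σ')
    (hpq : p ↔ q) (hB : B' ≤ B) : Answers B' q σ σ' :=
  ⟨h.reg, fun i hi => h.mem i (by omega), fun hq => h.pos (hpq.2 hq), fun hq => h.neg (by rwa [hpq])⟩

theorem HasInput.answers {n B : ℕ} {p : Prop} {A : ℕ → ℕ → Prop} {C : ℕ → ℕ → ℕ → ℕ → Prop}
    {σ σ' : State} (h : HasInput n A C σ) (h' : Answers B p σ σ') (hB : σ.reg 0 ≤ B) :
    HasInput n A C σ' where
  adj_lt a ha b hb := by rw [h'.reg 0 (by omega)]; exact h.adj_lt a ha b hb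
  adj a ha b hb := by
    rw [h'.mem _ ((h.adj_lt a ha b hb).trans_le hB)]; exact h.adj a ha b hb
  conflict_lt u hu v hv x hx y hy := by
    rw [h'.reg 0 (by omega)]; exact h.conflict_lt u hu v hv x hx y hy
  conflict u hu v hv x hx y hy := by
    rw [h'.mem _ ((h.conflict_lt u hu v hv x hx y hy).trans_le hB)]
    exact h.conflict u hu v hv x hx y hy

theorem Stores.answers {n B B' : ℕ} {p : Prop} {S : Set ℕ} {σ σ' : State} (h : Stores n B S σ)
    (h' : Answers B' p σ σ') (hB : B + n ≤ B') : Stores n B S σ' := fun v hv => by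
  rw [h'.mem _ (by omega), h v hv]

theorem pairsCmd_spec {n : ℕ} {A : ℕ → ℕ → Prop} {C : ℕ → ℕ → ℕ → ℕ → Prop} {σ : State}
    (hin : HasInput n A C σ) {X : Finset ℕ} (hXn : ∀ v ∈ X, v < n) {S : Set ℕ}
    (hX : Stores n (σ.reg 0) X σ) (hS : Stores n (σ.reg 0 + (n + n)) S σ) :
    Answers (σ.reg 0 + (n + n + (n + n)))
      (∃ w < n, ∃ w' < n, Consistent n C (· ∈ X) (· ∈ S) w w') σ (pairsCmd.eval n σ) := by
  set B := σ.reg 0 + (n + n + (n + n)) with hB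
  rw [pairsCmd, Cmd.eval, bound_false]
  refine iter_induction (n := n) (fun i τ =>
    Answers B (∃ w < i, ∃ w' < n, Consistent n C (· ∈ X) (· ∈ S) w w') σ τ) ?_
    (.refl _ (by simp) _)
  intro i τ hi hτ
  rw [Cmd.eval, bound_false]
  have := iter_induction (n := n) (f := fun j τ => extendCmd.eval n (τ.setReg 7 j))
    (fun j τ' => Answers B ((∃ w < i, ∃ w' < n, Consistent n C (· ∈ X) (· ∈ S) w w') ∨
      ∃ w' < j, Consistent n C (· ∈ X) (· ∈ S) i w') σ τ' ∧ τ'.reg 6 = i)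
    (a := τ.setReg 6 i) ?_ ⟨(hτ.setReg (by omega) _).congr (by simp) le_rfl, by simp⟩
  · refine this.1.congr ⟨?_, ?_⟩ le_rfl
    · rintro (⟨w, hw, h⟩ | h)
      exacts [⟨w, by omega, h⟩, ⟨i, by omega, h⟩]
    · rintro ⟨w, hw, h⟩
      rcases Nat.lt_succ_iff_lt_or_eq.1 hw with hw | rfl
      exacts [.inl ⟨w, hw, h⟩, .inr h]
  rintro j τ' hj ⟨h, h6⟩
  have h' := h.setReg (r := 7) (by omega) j
  have h0 := h'.reg 0 (by omega)
  have := extendCmd_spec (hin.answers h' (by omega)) hXn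
    (by rw [h0]; exact hX.answers h' (by omega)) (by rw [h0]; exact hS.answers h' (by omega))
  rw [h0] at this
  simp only [State.setReg_reg, Nat.reduceEqDiff, if_true, if_false, h6] at this
  refine ⟨(h'.trans this.1).congr ?_ le_rfl, this.2⟩
  rw [or_assoc]
  refine or_congr Iff.rfl ⟨?_, ?_⟩
  · rintro (⟨w, hw, h⟩ | h)
    exacts [⟨w, by omega, h⟩, ⟨j, by omega, h⟩]
  · rintro ⟨w, hw, h⟩
    rcases Nat.lt_succ_iff_lt_or_eq.1 hw with hw | hw
    exacts [.inl ⟨w, hw, h⟩, .inr (hw ▸ h)]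

end ConflictFreeCut

/-! ### The searches over bit strings -/

namespace ConflictFreeCut

open RAM

theorem HasInput.setReg {n : ℕ} {A : ℕ → ℕ → Prop} {C : ℕ → ℕ → ℕ → ℕ → Prop} {σ : State}
    (h : HasInput n A C σ) {r : ℕ} (hr : r ≠ 0) (v : ℕ) : HasInput n A C (σ.setReg r v) where
  adj_lt := by rw [State.setReg_reg, if_neg hr.symm]; exact h.adj_lt
  adj := h.adj
  conflict_lt := by rw [State.setReg_reg, if_neg hr.symm]; exact h.conflict_lt
  conflict := h.conflict

/-- One pass of the search for a vertex cover. -/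
def searchBody : Cmd :=
  .seq (.assign 3 (.sub (.var 3) (.lit 1))) (.ite (.var 4)
    (.seq coverCmd (.ite (.lt (.var 1) (.var 9)) .skip (.assign 4 (.lit 0)))) .skip)

/-- A vertex cover with at most `k` vertices is in the memory. -/
def Found (n : ℕ) (A : ℕ → ℕ → Prop) (k : ℕ) (σ : State) : Prop :=
  ∃ X : Finset ℕ, (∀ v ∈ X, v < n) ∧ X.card ≤ k ∧ (∀ a b, A a b → a ∈ X ∨ b ∈ X) ∧
    Stores n (σ.reg 0) X σ

/-- The state after `j` passes of the search with budget `k`. -/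
structure SearchInv (n : ℕ) (A : ℕ → ℕ → Prop) (C : ℕ → ℕ → ℕ → ℕ → Prop) (k j : ℕ)
    (σ : State) : Prop where
  input : HasInput n A C σ
  budget : σ.reg 1 = k
  power : σ.reg 2 = 2 ^ k
  bits : σ.reg 3 = 2 ^ k - j
  answer : σ.reg 5 = 0
  result : (σ.reg 4 = 0 ∧ Found n A k σ ∧ ∃ c < 2 ^ k, (cover n A (2 ^ k) c).2.1 ≤ k) ∨
    (σ.reg 4 = 1 ∧ ∀ c < 2 ^ k, 2 ^ k - j ≤ c → k < (cover n A (2 ^ k) c).2.1)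

/-- Variable `3` is decreased before use, so this pass tries the string `2 ^ k - (j + 1)`, and `0`
is the last one tried. After a success the flag reduces the remaining passes to counting. -/
theorem searchBody_spec {n : ℕ} {A : ℕ → ℕ → Prop} {C : ℕ → ℕ → ℕ → ℕ → Prop}
    (hA : ∀ a b, A a b → a < n ∧ b < n) {k j : ℕ} {σ : State} (h : SearchInv n A C k j σ)
    (hj : j < 2 ^ k) : SearchInv n A C k (j + 1) (searchBody.eval n σ) := by
  rw [searchBody, Cmd.eval, Cmd.eval]
  simp only [Expr.eval, h.bits, Nat.sub_sub]
  set τ := σ.setReg 3 (2 ^ k - (j + 1)) with hτ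
  have hin : HasInput n A C τ := h.input.setReg (by omega) _
  have t0 : τ.reg 0 = σ.reg 0 := rfl
  have t1 : τ.reg 1 = k := h.budget
  have t2 : τ.reg 2 = 2 ^ k := h.power
  have t3 : τ.reg 3 = 2 ^ k - (j + 1) := by simp [hτ]
  have t4 : τ.reg 4 = σ.reg 4 := rfl
  have t5 : τ.reg 5 = 0 := h.answer
  rcases h.result with ⟨h4, hX, hc⟩ | ⟨h4, hc⟩
  · rw [Cmd.eval_ite_neg (by simp [Expr.Holds, Expr.eval, t4, h4]), Cmd.eval]
    exact ⟨hin, t1, t2, t3, t5, .inl ⟨t4.trans h4, hX, hc⟩⟩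
  · rw [Cmd.eval_ite_pos (by simp [Expr.Holds, Expr.eval, t4, h4]), Cmd.eval]
    have hcov := coverCmd_spec hin
    rw [t2, t3] at hcov
    have f := hcov.frame
    have u1 := (f.reg 1 (by omega)).trans t1
    have hcond : (Expr.lt (.var 1) (.var 9)).Holds n (coverCmd.eval n τ) ↔
        k < (cover n A (2 ^ k) (2 ^ k - (j + 1))).2.1 := by
      rw [Expr.holds_lt, Expr.eval, Expr.eval, u1, hcov.counter]
    by_cases hlt : k < (cover n A (2 ^ k) (2 ^ k - (j + 1))).2.1
    · rw [Cmd.eval_ite_pos (hcond.2 hlt), Cmd.eval]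
      refine ⟨hin.frame f le_rfl, u1, (f.reg 2 (by omega)).trans t2,
        (f.reg 3 (by omega)).trans t3, (f.reg 5 (by omega)).trans t5,
        .inr ⟨(f.reg 4 (by omega)).trans (t4.trans h4), fun c hck hcj => ?_⟩⟩
      by_cases he : c = 2 ^ k - (j + 1)
      · rwa [he]
      · exact hc c hck (by omega)
    · rw [Cmd.eval_ite_neg (mt hcond.1 hlt), Cmd.eval, Expr.eval]
      obtain ⟨s1, s2⟩ := cover_small hA (2 ^ k) (2 ^ k - (j + 1))
      refine ⟨(hin.frame f le_rfl).setReg (by omega) _, u1, (f.reg 2 (by omega)).trans t2,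
        (f.reg 3 (by omega)).trans t3, (f.reg 5 (by omega)).trans t5, .inl ⟨by simp,
        ⟨_, s2, by omega, fun a b hab => cover_covers hA _ _ hab, ?_⟩,
        ⟨_, by omega, not_lt.1 hlt⟩⟩⟩
      have := hcov.stores
      rw [← f.reg 0 (by omega)] at this
      exact this

/-- Reset the bits. -/
def resetCmd : Cmd := .assign 3 (.var 2)

/-- Increase the budget unless a vertex cover has been found. -/
def growCmd : Cmd :=
  .ite (.var 4) (.seq (.assign 1 (.add (.var 1) (.lit 1))) (.assign 2 (.add (.var 2) (.var 2))))
    .skip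

/-- The search for a vertex cover with a fixed budget. -/
def budgetProgram : Program :=
  .seq (resetCmd.compile 0) (.seq (.loop (2 * 3 + 5) (searchBody.compile 0)) (growCmd.compile 0))

/-- The state after the budgets below `j` have been tried, where `J` is the first that suffices. -/
structure BudgetInv (n : ℕ) (A : ℕ → ℕ → Prop) (C : ℕ → ℕ → ℕ → ℕ → Prop) (J j : ℕ)
    (σ : State) : Prop where
  input : HasInput n A C σ
  answer : σ.reg 5 = 0
  before : j ≤ J → σ.reg 4 = 1 ∧ σ.reg 1 = j ∧ σ.reg 2 = 2 ^ j
  after : J < j → σ.reg 4 = 0 ∧ σ.reg 2 = 2 ^ J ∧ Found n A J σ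

/-- Below `J` no string succeeds and the budget grows; at `J` some string succeeds and its cover
stays in memory. -/
theorem budgetProgram_spec {n : ℕ} {A : ℕ → ℕ → Prop} {C : ℕ → ℕ → ℕ → ℕ → Prop}
    (hA : ∀ a b, A a b → a < n ∧ b < n) {J j : ℕ} (hj : j ≤ J)
    (hlt : ∀ k < J, ∀ c < 2 ^ k, k < (cover n A (2 ^ k) c).2.1)
    (hJ : ∃ c < 2 ^ J, (cover n A (2 ^ J) c).2.1 ≤ J) :
    Triple n (BudgetInv n A C J j) budgetProgram (BudgetInv n A C J (j + 1))
      (resetCmd.cost n + (2 ^ j * (searchBody.cost n + 1) + 1 + growCmd.cost n)) := by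
  refine (Triple.cmd (post := SearchInv n A C j 0) resetCmd ?_).seq
    (Triple.seq (mid := SearchInv n A C j (2 ^ j)) ?_ (Triple.cmd growCmd ?_))
  · intro σ h
    obtain ⟨h4, h1, h2⟩ := h.before hj
    rw [resetCmd, Cmd.eval, Expr.eval, h2]
    exact ⟨h.input.setReg (by omega) _, h1, h2, by simp, h.answer,
      .inr ⟨h4, fun c hc hc' => absurd hc (by omega)⟩⟩
  · have := Triple.loop (n := n) (v := 3) (N := 2 ^ j) (P := searchBody.compile 0)
      (SearchInv n A C j) (T := fun _ => searchBody.cost n)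
      (fun i σ hi h => by rw [h.bits]; omega) (fun σ h => by rw [h.bits]; omega)
      (fun i hi => Triple.cmd searchBody fun σ h => searchBody_spec hA h hi)
    simpa using this
  · intro σ h
    rcases h.result with ⟨h4, hX, c, hc, hcj⟩ | ⟨h4, hc⟩
    -- The successful string kept in the invariant rules out a budget below `J`.
    · have hjJ : j = J := by
        by_contra hne
        exact absurd (hlt j (by omega) c hc) (by omega)
      subst hjJ
      rw [growCmd, Cmd.eval_ite_neg (by simp [Expr.Holds, Expr.eval, h4]), Cmd.eval]
      exact ⟨h.input, h.answer, fun h' => absurd h' (by omega), fun _ => ⟨h4, h.power, hX⟩⟩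
    · have hjJ : j ≠ J := by
        rintro rfl
        obtain ⟨c, hc1, hc2⟩ := hJ
        exact absurd (hc c hc1 (by omega)) (by omega)
      rw [growCmd, Cmd.eval_ite_pos (by simp [Expr.Holds, Expr.eval, h4]), Cmd.eval, Cmd.eval,
        Cmd.eval]
      refine ⟨(h.input.setReg (by omega) _).setReg (by omega) _, h.answer, fun _ => ⟨h4, ?_, ?_⟩,
        fun h' => absurd h' (by omega)⟩
      · simp [Expr.eval, h.budget]
      · simp [Expr.eval, h.power, pow_succ, mul_two]

/-- One pass of the test of all colourings. -/
def answerBody : Cmd :=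
  .seq (.assign 3 (.sub (.var 3) (.lit 1))) (.seq colourCmd pairsCmd)

/-- The bits `c` give a colouring of the vertex cover `X` that can be extended. -/
def Extendable (n : ℕ) (C : ℕ → ℕ → ℕ → ℕ → Prop) (X : Finset ℕ) (J c : ℕ) : Prop :=
  ∃ w < n, ∃ w' < n,
    Consistent n C (· ∈ X) (· ∈ (iter (colourStep X (2 ^ J)) n (∅, c)).1) w w'

/-- The state after `j` passes of the test of all colourings. -/
structure AnswerInv (n : ℕ) (A : ℕ → ℕ → Prop) (C : ℕ → ℕ → ℕ → ℕ → Prop) (X : Finset ℕ)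
    (J j : ℕ) (σ : State) : Prop where
  input : HasInput n A C σ
  power : σ.reg 2 = 2 ^ J
  bits : σ.reg 3 = 2 ^ J - j
  stores : Stores n (σ.reg 0) X σ
  pos : (∃ c < 2 ^ J, 2 ^ J - j ≤ c ∧ Extendable n C X J c) → σ.reg 5 = 1
  neg : ¬ (∃ c < 2 ^ J, 2 ^ J - j ≤ c ∧ Extendable n C X J c) → σ.reg 5 = 0

/-- The answer is never switched off, so it accumulates the disjunction over the strings tried so
far. -/
theorem answerBody_spec {n : ℕ} {A : ℕ → ℕ → Prop} {C : ℕ → ℕ → ℕ → ℕ → Prop} {X : Finset ℕ}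
    (hX : ∀ v ∈ X, v < n) {J j : ℕ} {σ : State} (h : AnswerInv n A C X J j σ) (hj : j < 2 ^ J) :
    AnswerInv n A C X J (j + 1) (answerBody.eval n σ) := by
  rw [answerBody, Cmd.eval, Cmd.eval, Cmd.eval]
  simp only [Expr.eval, h.bits, Nat.sub_sub]
  set τ := σ.setReg 3 (2 ^ J - (j + 1)) with hτ
  have hin : HasInput n A C τ := h.input.setReg (by omega) _
  have t2 : τ.reg 2 = 2 ^ J := h.power
  have t3 : τ.reg 3 = 2 ^ J - (j + 1) := by simp [hτ]
  have t5 : τ.reg 5 = σ.reg 5 := rfl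
  have hst : Stores n (τ.reg 0) X τ := h.stores
  have hcol := colourCmd_spec hst
  rw [t2, t3] at hcol
  have f := hcol.frame
  have f0 := f.reg 0 (by omega)
  have hst' : Stores n ((colourCmd.eval n τ).reg 0) X (colourCmd.eval n τ) := by
    rw [f0]; exact hst.frame f (by omega)
  have hans := pairsCmd_spec (hin.frame f (by omega)) hX hst' (by rw [f0]; exact hcol.stores)
  have e : (∃ c < 2 ^ J, 2 ^ J - (j + 1) ≤ c ∧ Extendable n C X J c) ↔
      (∃ c < 2 ^ J, 2 ^ J - j ≤ c ∧ Extendable n C X J c) ∨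
        Extendable n C X J (2 ^ J - (j + 1)) := by
    constructor
    · rintro ⟨c, hc, hcj, hE⟩
      by_cases he : c = 2 ^ J - (j + 1)
      · exact .inr (he ▸ hE)
      · exact .inl ⟨c, hc, by omega, hE⟩
    · rintro (⟨c, hc, hcj, hE⟩ | hE)
      exacts [⟨c, hc, by omega, hE⟩, ⟨_, by omega, le_rfl, hE⟩]
  refine ⟨(hin.frame f (by omega)).answers hans (by omega),
    (hans.reg 2 (by omega)).trans ((f.reg 2 (by omega)).trans t2),
    (hans.reg 3 (by omega)).trans ((f.reg 3 (by omega)).trans t3), ?_, ?_, ?_⟩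
  · rw [hans.reg 0 (by omega)]
    exact hst'.answers hans (by omega)
  · rw [e]
    intro hE
    by_cases hE' : Extendable n C X J (2 ^ J - (j + 1))
    · exact hans.pos hE'
    · rw [hans.neg hE', f.reg 5 (by omega), t5]
      exact h.pos (hE.resolve_right hE')
  · rw [e, not_or]
    rintro ⟨hE, hE'⟩
    rw [hans.neg hE', f.reg 5 (by omega), t5]
    exact h.neg hE

def initCmd : Cmd := .seq (.assign 2 (.lit 1)) (.assign 4 (.lit 1))

/-- The algorithm, after the size of the graph has been read. -/
def mainProgram : Program :=
  .seq (initCmd.compile 0) (.seq (.loop (2 * 4 + 5) budgetProgram)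
    (.seq (resetCmd.compile 0) (.loop (2 * 3 + 5) (answerBody.compile 0))))

/-- A bound for the running time of the algorithm, up to the factor `2 ^ J`. -/
def mainCost (n : ℕ) : ℕ :=
  initCmd.cost n + 2 * (resetCmd.cost n + searchBody.cost n + growCmd.cost n + 3) +
    resetCmd.cost n + answerBody.cost n + 3

/-- `hp` makes the outcome independent of the cover that is found. The budgets `0, …, J` cost a
geometric sum of passes, bounded by `2 ^ (J + 1)`; this is the factor `2` in `mainCost`. The
colourings take `2 ^ J` further passes. -/
theorem mainProgram_spec {n : ℕ} {A : ℕ → ℕ → Prop} {C : ℕ → ℕ → ℕ → ℕ → Prop}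
    (hA : ∀ a b, A a b → a < n ∧ b < n) {J : ℕ}
    (hlt : ∀ k < J, ∀ c < 2 ^ k, k < (cover n A (2 ^ k) c).2.1)
    (hJ : ∃ c < 2 ^ J, (cover n A (2 ^ J) c).2.1 ≤ J) {p : Prop}
    (hp : ∀ X : Finset ℕ, (∀ v ∈ X, v < n) → X.card ≤ J → (∀ a b, A a b → a ∈ X ∨ b ∈ X) →
      ((∃ c < 2 ^ J, Extendable n C X J c) ↔ p)) :
    Triple n (fun σ => HasInput n A C σ ∧ σ.reg 1 = 0 ∧ σ.reg 5 = 0) mainProgram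
      (fun σ => (p → σ.reg 5 = 1) ∧ (¬ p → σ.reg 5 = 0)) (2 ^ J * mainCost n) := by
  have h1 : Triple n (fun σ => HasInput n A C σ ∧ σ.reg 1 = 0 ∧ σ.reg 5 = 0)
      (initCmd.compile 0) (BudgetInv n A C J 0) (initCmd.cost n) :=
    Triple.cmd initCmd fun σ h =>
      ⟨(h.1.setReg (by omega) _).setReg (by omega) _, h.2.2,
        fun _ => ⟨by simp [initCmd, Cmd.eval, Expr.eval], h.2.1,
          by simp [initCmd, Cmd.eval, Expr.eval]⟩,
        fun h' => absurd h' (by omega)⟩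
  have h2 := Triple.loop (n := n) (v := 4) (N := J + 1) (P := budgetProgram)
    (BudgetInv n A C J) (fun j σ hj h => by rw [(h.before (by omega)).1]; omega)
    (fun σ h => (h.after (by omega)).1)
    (fun j hj => budgetProgram_spec (C := C) hA (by omega) hlt hJ)
  have h3 : Triple n (BudgetInv n A C J (J + 1)) (resetCmd.compile 0)
      (fun σ => ∃ X : Finset ℕ, (∀ v ∈ X, v < n) ∧ X.card ≤ J ∧ (∀ a b, A a b → a ∈ X ∨ b ∈ X) ∧
        AnswerInv n A C X J 0 σ) (resetCmd.cost n) :=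
    Triple.cmd resetCmd fun σ h => by
      obtain ⟨h4, h2, X, hXn, hXJ, hXA, hX⟩ := h.after (by omega)
      rw [resetCmd, Cmd.eval, Expr.eval, h2]
      exact ⟨X, hXn, hXJ, hXA, h.input.setReg (by omega) _, h2, by simp, hX,
        fun ⟨c, hc, hc', _⟩ => absurd hc (by omega), fun _ => h.answer⟩
  have h4 : Triple n (fun σ => ∃ X : Finset ℕ, (∀ v ∈ X, v < n) ∧ X.card ≤ J ∧
      (∀ a b, A a b → a ∈ X ∨ b ∈ X) ∧ AnswerInv n A C X J 0 σ)
      (.loop (2 * 3 + 5) (answerBody.compile 0))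
      (fun σ => (p → σ.reg 5 = 1) ∧ (¬ p → σ.reg 5 = 0))
      (2 ^ J * (answerBody.cost n + 1) + 1) := by
    rintro s σ hs ⟨X, hXn, hXJ, hXA, hσ⟩
    have := Triple.loop (n := n) (v := 3) (N := 2 ^ J) (P := answerBody.compile 0)
      (AnswerInv n A C X J) (T := fun _ => answerBody.cost n)
      (fun i σ hi h => by rw [h.bits]; omega) (fun σ h => by rw [h.bits]; omega)
      (fun i hi => Triple.cmd answerBody fun σ h => answerBody_spec hXn h hi)
    refine this.mono (fun _ h => h) (fun σ' h => ?_) (by simp) s σ hs hσ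
    have e := hp X hXn hXJ hXA
    have hpos := h.pos
    have hneg := h.neg
    simp only [Nat.sub_self, Nat.zero_le, true_and] at hpos hneg
    rw [e] at hpos hneg
    exact ⟨hpos, hneg⟩
  refine (h1.seq (h2.seq (h3.seq h4))).mono (fun _ h => h) (fun _ h => h) ?_
  have hpow : 1 ≤ 2 ^ J := Nat.one_le_two_pow
  have hsum : ∑ j ∈ Finset.range (J + 1), (resetCmd.cost n + (2 ^ j * (searchBody.cost n + 1) + 1 +
      growCmd.cost n) + 1) ≤
      2 ^ J * (2 * (resetCmd.cost n + searchBody.cost n + growCmd.cost n + 3)) := by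
    -- Costs that occur once per budget are absorbed by `1 ≤ 2 ^ j`; the `3` collects the branching
    -- steps.
    calc _ ≤ ∑ j ∈ Finset.range (J + 1),
          2 ^ j * (resetCmd.cost n + searchBody.cost n + growCmd.cost n + 3) := by
          refine Finset.sum_le_sum fun j _ => ?_
          have : 1 ≤ 2 ^ j := Nat.one_le_two_pow
          nlinarith [Nat.zero_le (resetCmd.cost n), Nat.zero_le (growCmd.cost n)]
      _ = (∑ j ∈ Finset.range (J + 1), 2 ^ j) *
          (resetCmd.cost n + searchBody.cost n + growCmd.cost n + 3) := by rw [Finset.sum_mul]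
      _ ≤ 2 ^ (J + 1) * (resetCmd.cost n + searchBody.cost n + growCmd.cost n + 3) := by
          gcongr
          have := Nat.geomSum_lt (n := J + 1) (s := Finset.range (J + 1)) (le_refl 2)
            (by simp)
          omega
      _ = _ := by rw [pow_succ]; ring
  have i1 := Nat.mul_le_mul_right (initCmd.cost n) hpow
  have i2 := Nat.mul_le_mul_right (resetCmd.cost n) hpow
  simp only [mainCost, Nat.mul_add, mul_one, one_mul] at *
  omega

open Polynomial in
theorem exists_mainCost_polynomial : ∃ p : ℕ[X], ∀ n, p.eval n = mainCost n := by
  obtain ⟨p₁, h₁⟩ := initCmd.exists_cost_polynomial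
  obtain ⟨p₂, h₂⟩ := resetCmd.exists_cost_polynomial
  obtain ⟨p₃, h₃⟩ := searchBody.exists_cost_polynomial
  obtain ⟨p₄, h₄⟩ := growCmd.exists_cost_polynomial
  obtain ⟨p₅, h₅⟩ := answerBody.exists_cost_polynomial
  exact ⟨p₁ + 2 * (p₂ + p₃ + p₄ + 3) + p₂ + p₅ + 3, fun n => by
    simp [mainCost, h₁, h₂, h₃, h₄, h₅]⟩

theorem Instance.ConflictNat.lt {I : Instance} {u v x y : ℕ} (h : I.ConflictNat u v x y) :
    u < I.n := h.1

theorem Instance.AdjNat.lt {I : Instance} {u v : ℕ} (h : I.AdjNat u v) : u < I.n ∧ v < I.n :=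
  ⟨h.1, h.2.1⟩

/-- A solution restricts to a colouring of `X`, which some string of `J` bits produces because
`X.card ≤ J`; conversely, consistency provides a full colouring. -/
theorem Instance.exists_extendable_iff (I : Instance) {J : ℕ} {X : Finset ℕ}
    (hXn : ∀ v ∈ X, v < I.n) (hXJ : X.card ≤ J) (hX : ∀ a b, I.AdjNat a b → a ∈ X ∨ b ∈ X) :
    (∃ c < 2 ^ J, Extendable I.n I.ConflictNat X J c) ↔ I.HasConflictFreeCut := by
  have key := fun col w w' (hw : w < I.n) (hw' : w' < I.n) =>
    consistent_iff (n := I.n) (C := I.ConflictNat) (X := (· ∈ X)) (col := col)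
      (fun _ _ _ _ h => h.symm) (fun _ _ _ _ h => h.swap) (fun _ _ _ _ h => h.lt)
      (fun _ _ _ _ h => hX _ _ h.adj) hXn hw hw'
  rw [I.hasConflictFreeCut_iff]
  constructor
  · rintro ⟨c, hc, w, hw, w', hw', h⟩
    rw [key _ _ _ hw hw'] at h
    obtain ⟨χ, -, h⟩ := h
    exact ⟨w, hw, w', hw', χ, h⟩
  · rintro ⟨w, hw, w', hw', χ, h⟩
    obtain ⟨c, hc, hcol⟩ := exists_colour hXn hXJ {v | χ v} ∅
    refine ⟨c, hc, w, hw, w', hw', ?_⟩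
    rw [key _ _ _ hw hw']
    exact ⟨χ, fun v hv => (hcol v hv).symm, h⟩

/-! ### Reading the input -/

/-- Read the number `n`, given in unary, into register `1`, and put `2 * n` into register `3`. -/
def readProgram : Program :=
  .seq (move 5 0) (.seq (.load 2 1) (.seq
    (.loop 2 (.seq (.const 4 1) (.seq (.add 1 1 4) (.load 2 1)))) (.add 3 1 1)))

/-- Register `5` is variable `0`, so the length of the word is saved there before register `0`
becomes scratch. A symbol costs three instructions and a branching step; the `5` counts the two-step
move, the first load, the exit and the doubling. -/
theorem readProgram_runs {n : ℕ} {s : State} (h : ∀ i < n, s.mem i ≠ 0) (hn : s.mem n = 0)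
    (hs : ∀ r, r ≠ 0 → s.reg r = 0) :
    ∃ s' t, Runs readProgram s s' t ∧ t ≤ 4 * n + 5 ∧
      Represents n s' ⟨fun v => if v = 0 then s.reg 0 else 0, s.mem⟩ := by
  have key : ∀ m i s', i + m = n → s'.mem = s.mem → s'.reg 1 = i → s'.reg 2 = s.mem i →
      ∃ s'' t, Runs (.loop 2 (.seq (.const 4 1) (.seq (.add 1 1 4) (.load 2 1)))) s' s'' t ∧
        t ≤ 4 * m + 1 ∧ s''.mem = s.mem ∧ s''.reg 1 = n ∧
          ∀ r, r ≠ 1 → r ≠ 2 → r ≠ 4 → s''.reg r = s'.reg r := by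
    intro m
    induction m with
    | zero =>
      intro i s' hi hm h1 h2
      obtain rfl : i = n := by omega
      exact ⟨s', 1, .loop_exit (by rw [h2, hn]), le_rfl, hm, h1, fun _ _ _ _ => rfl⟩
    | succ m ih =>
      intro i s' hi hm h1 h2
      have r₁ := Runs.add 1 1 4 (s'.setReg 4 1)
      have e₁ : (s'.setReg 4 1).reg 1 + (s'.setReg 4 1).reg 4 = i + 1 := by simp [h1]
      rw [e₁] at r₁
      have r₂ := Runs.load 2 1 ((s'.setReg 4 1).setReg 1 (i + 1))
      have e₂ : ((s'.setReg 4 1).setReg 1 (i + 1)).mem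
          (((s'.setReg 4 1).setReg 1 (i + 1)).reg 1) = s.mem (i + 1) := by simp [hm]
      rw [e₂] at r₂
      obtain ⟨s'', t, hr, ht, e1, e2, e3⟩ := ih (i + 1)
        (((s'.setReg 4 1).setReg 1 (i + 1)).setReg 2 (s.mem (i + 1))) (by omega)
        (by simpa using hm) (by simp) (by simp)
      refine ⟨s'', _, .loop_step (by rw [h2]; exact h i (by omega))
        (.seq (.const 4 1 s') (.seq r₁ r₂)) hr, by omega, e1, e2, fun r hr1 hr2 hr4 => ?_⟩
      rw [e3 r hr1 hr2 hr4]
      simp [hr1, hr2, hr4]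
  have r₁ := move_runs (r := 5) (a := 0) (by omega) s
  have r₂ := Runs.load 2 1 (s.setReg 5 (s.reg 0))
  obtain ⟨s', t, hr, ht, e1, e2, e3⟩ := key n 0
    ((s.setReg 5 (s.reg 0)).setReg 2 ((s.setReg 5 (s.reg 0)).mem ((s.setReg 5 (s.reg 0)).reg 1)))
    (by omega) rfl (by simp [hs]) (by simp [hs])
  refine ⟨_, _, .seq r₁ (.seq r₂ (.seq hr (.add 3 1 1 s'))), by omega, by simp [e2],
    by simp [e2], fun v => ?_, e1⟩
  rw [State.setReg_reg, if_neg (by omega), e3 _ (by omega) (by omega) (by omega),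
    State.setReg_reg, if_neg (by omega), State.setReg_reg]
  by_cases hv : v = 0
  · simp [hv]
  · rw [if_neg (by omega), hs _ (by omega)]
    simp [hv]

theorem Instance.length_encode (I : Instance) :
    I.encode.length = I.n + 1 + I.n * I.n + (I.n * I.n) * (I.n * I.n) := by
  simp only [Instance.encode, List.length_append, List.length_replicate, List.length_singleton,
    List.length_ofFn]

theorem pair_lt {a b n m : ℕ} (ha : a < m) (hb : b < n) : n * a + b < m * n := by
  have := Nat.mul_le_mul_left n ha
  rw [Nat.mul_succ, Nat.mul_comm n m] at this
  omega

theorem Instance.encode_size (I : Instance) {i : ℕ} (hi : i < I.n) :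
    I.encode[i]? = some true := by
  have h1 : i < (List.replicate I.n true ++ [false]).length := by simp; omega
  rw [Instance.encode, List.append_assoc, List.getElem?_append_left h1,
    List.getElem?_append_left (by simpa using hi)]
  simp [hi]

theorem Instance.encode_separator (I : Instance) : I.encode[I.n]? = some false := by
  have h1 : I.n < (List.replicate I.n true ++ [false]).length := by simp
  rw [Instance.encode, List.append_assoc, List.getElem?_append_left h1,
    List.getElem?_append_right (by simp)]
  simp

theorem Instance.encode_adj (I : Instance) {a b : ℕ} (ha : a < I.n) (hb : b < I.n) :
    I.encode[I.n + 1 + (I.n * a + b)]? = some true ↔ I.AdjNat a b := by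
  have h := pair_lt ha hb
  have hd : (I.n * a + b) / I.n = a := by
    rw [Nat.mul_add_div (by omega), Nat.div_eq_of_lt hb, add_zero]
  have hm : (I.n * a + b) % I.n = b := by rw [Nat.mul_add_mod, Nat.mod_eq_of_lt hb]
  rw [Instance.encode, List.append_assoc, List.getElem?_append_right (by simp),
    List.getElem?_append_left (by simp; omega)]
  simp only [List.length_append, List.length_replicate, List.length_singleton,
    Nat.add_sub_cancel_left]
  rw [List.getElem?_eq_getElem (by simpa using h)]
  simp only [List.getElem_ofFn, Option.some.injEq, decide_eq_true_eq]
  simp only [Fin.divNat, Fin.modNat,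
    hd, hm, Instance.AdjNat, ha, hb, exists_true_left]

theorem Instance.encode_conflict (I : Instance) {u v x y : ℕ} (hu : u < I.n) (hv : v < I.n)
    (hx : x < I.n) (hy : y < I.n) :
    I.encode[I.n + 1 + I.n * I.n + (I.n * (I.n * (I.n * u + v) + x) + y)]? = some true ↔
      I.ConflictNat u v x y := by
  set n := I.n with hn
  have div : ∀ a b, b < n → (n * a + b) / n = a := fun a b hb => by
    rw [Nat.mul_add_div (by omega), Nat.div_eq_of_lt hb, add_zero]
  have mod : ∀ a b, b < n → (n * a + b) % n = b := fun a b hb => by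
    rw [Nat.mul_add_mod, Nat.mod_eq_of_lt hb]
  -- Regrouping in base `n * n` exposes row and column of the conflict matrix as quotient and
  -- remainder.
  have e : n * (n * (n * u + v) + x) + y = n * n * (n * u + v) + (n * x + y) := by ring
  have hxy := pair_lt hx hy
  have huv := pair_lt hu hv
  have h := pair_lt huv hxy
  have hd : (n * (n * (n * u + v) + x) + y) / (n * n) = n * u + v := by
    rw [e, Nat.mul_add_div (by omega), Nat.div_eq_of_lt hxy, add_zero]
  have hm : (n * (n * (n * u + v) + x) + y) % (n * n) = n * x + y := by
    rw [e, Nat.mul_add_mod, Nat.mod_eq_of_lt hxy]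
  rw [← e] at h
  rw [Instance.encode, List.getElem?_append_right (by simp [← hn]; omega)]
  simp only [List.length_append, List.length_replicate, List.length_singleton,
    List.length_ofFn, ← hn, Nat.add_sub_cancel_left]
  rw [List.getElem?_eq_getElem (by simpa using h)]
  simp only [List.getElem_ofFn, Option.some.injEq, decide_eq_true_eq]
  simp only [Fin.divNat, Fin.modNat, Fin.val_cast,
    ← hn, hd, hm, div _ _ hv, div _ _ hy, mod _ _ hv, mod _ _ hy, Instance.ConflictNat, hu, hv, hx,
    hy, exists_true_left]

theorem Instance.hasInput (I : Instance) : HasInput I.n I.AdjNat I.ConflictNat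
    ⟨fun v => if v = 0 then (State.start I.encode).reg 0 else 0, (State.start I.encode).mem⟩ where
  adj_lt a ha b hb := by
    have := pair_lt ha hb
    simp only [State.start, if_true, I.length_encode]
    omega
  adj a ha b hb := by
    rw [← I.encode_adj ha hb]
    simp [State.start]
  conflict_lt u hu v hv x hx y hy := by
    have := pair_lt (pair_lt hu hv) (pair_lt hx hy)
    simp only [State.start, if_true, I.length_encode]
    rw [show I.n * (I.n * (I.n * u + v) + x) + y =
      I.n * I.n * (I.n * u + v) + (I.n * x + y) by ring]
    omega
  conflict u hu v hv x hx y hy := by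
    rw [← I.encode_conflict hu hv hx hy]
    simp [State.start]

/-! ### The complete algorithm -/

/-- The algorithm for Conflict-Free Cut. -/
def program : Program := .seq readProgram (.seq mainProgram (move 0 (2 * 5 + 5)))

/-- The first sufficient budget is `Nat.find hex`; a minimum vertex cover shows that it is at most
the vertex cover number, which is all the time bound needs. The `7` consists of `5` steps from
reading and `2` for copying the answer to register `0`. -/
theorem program_decides : program.DecidesInTime Instance.encode Instance.HasConflictFreeCut
    (fun I => 2 ^ I.vertexCoverNumber * (mainCost I.n + 4 * I.n + 7)) := by
  classical
  intro I
  obtain ⟨D, hD, hDA⟩ := I.exists_vertexCover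
  have hex : ∃ k, ∃ c < 2 ^ k, (cover I.n I.AdjNat (2 ^ k) c).2.1 ≤ k :=
    ⟨_, exists_cover_le hDA le_rfl⟩
  have hJ : Nat.find hex ≤ I.vertexCoverNumber := Nat.find_min' hex (exists_cover_le hDA hD.le)
  obtain ⟨s₁, t₁, r₁, ht₁, h₁⟩ := readProgram_runs (n := I.n) (s := State.start I.encode)
    (fun i hi => by simp [State.start, I.encode_size hi])
    (by simp [State.start, I.encode_separator]) (fun r hr => by simp [State.start, hr])
  obtain ⟨s₂, σ, t₂, r₂, ht₂, h₂, hpos, hneg⟩ := mainProgram_spec (C := I.ConflictNat)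
    (fun a b h => h.lt) (J := Nat.find hex)
    (fun k hk c hc => not_le.1 fun h => Nat.find_min hex hk ⟨c, hc, h⟩) (Nat.find_spec hex)
    (p := I.HasConflictFreeCut) (fun X hXn hXJ hX => I.exists_extendable_iff hXn hXJ hX) s₁ _ h₁
    ⟨I.hasInput, rfl, rfl⟩
  refine ⟨_, _, .seq r₁ (.seq r₂ (move_runs (by omega) s₂)), ?_, fun h => ?_, fun h => ?_⟩
  · have i1 := Nat.mul_le_mul_right (mainCost I.n) (Nat.pow_le_pow_right (n := 2) (by omega) hJ)
    have i2 := Nat.mul_le_mul_right (4 * I.n + 7)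
      (Nat.one_le_two_pow (n := I.vertexCoverNumber))
    change t₁ + (t₂ + 2) ≤ 2 ^ I.vertexCoverNumber * (mainCost I.n + 4 * I.n + 7)
    rw [add_assoc (mainCost I.n), Nat.mul_add]
    omega
  · rw [State.setReg_reg, if_pos rfl, h₂.var, hpos h]
  · rw [State.setReg_reg, if_pos rfl, h₂.var, hneg h]

theorem computable_two_pow : Computable fun k : ℕ => 2 ^ k := by
  refine Primrec.to_comp ((Primrec.nat_rec₁ 1 ((Primrec.nat_mul.comp
    (Primrec.const 2) Primrec.snd).to₂)).of_eq fun k => ?_)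
  induction k with
  | zero => rfl
  | succ k ih => rw [pow_succ, mul_comm, ← ih]

/-- All coefficients are natural numbers. This turns the bound in the number of vertices into one in
the length of the word. -/
theorem eval_mono (p : Polynomial ℕ) {a b : ℕ} (h : a ≤ b) : p.eval a ≤ p.eval b := by
  rw [Polynomial.eval_eq_sum, Polynomial.eval_eq_sum]
  exact Finset.sum_le_sum fun i _ => Nat.mul_le_mul_left _ (Nat.pow_le_pow_left h i)

end ConflictFreeCut

/-- Conflict-Free Cut is fixed-parameter tractable with the vertex cover number `k` of the input
graph as the parameter; it can be decided in time `2 ^ k * n ^ O(1)`, where `n` is the number of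
vertices of the input graph. -/
theorem theorem2 :
    FixedParameterTractable ConflictFreeCut.Instance.encode
      ConflictFreeCut.Instance.HasConflictFreeCut
      ConflictFreeCut.Instance.vertexCoverNumber ∧
    ∃ (P : RAM.Program) (p : Polynomial ℕ),
      P.DecidesInTime ConflictFreeCut.Instance.encode
        ConflictFreeCut.Instance.HasConflictFreeCut
        (fun I => 2 ^ I.vertexCoverNumber * p.eval I.n) := by
  obtain ⟨q, hq⟩ := ConflictFreeCut.exists_mainCost_polynomial
  have hp : ∀ n, (q + 4 * Polynomial.X + 7).eval n = ConflictFreeCut.mainCost n + 4 * n + 7 := by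
    simp [hq]
  refine ⟨⟨fun k => 2 ^ k, q + 4 * Polynomial.X + 7, ConflictFreeCut.program,
    ConflictFreeCut.computable_two_pow, fun I => ?_⟩,
    ConflictFreeCut.program, q + 4 * Polynomial.X + 7, fun I => ?_⟩
  · obtain ⟨s, t, hr, ht, h⟩ := ConflictFreeCut.program_decides I
    refine ⟨s, t, hr, ht.trans (Nat.mul_le_mul_left _ ?_), h⟩
    rw [← hp]
    exact ConflictFreeCut.eval_mono _ (by rw [I.length_encode]; omega)
  · simp only [hp]
    exact ConflictFreeCut.program_decides I
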